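/- Let $d\ge 2$, $\mathbb T=\mathbb R/\mathbb Z$, let $\|t\|$ denote the distance from $t$ to the nearest integer, and equip $\mathbb T^d$ with Haar probability measure and the distance $|x-y|=\max_{1\le j\le d}\|x_j-y_j\|$. For $\gamma>0$ let $\mathrm{DC}(\mathbb T)_\gamma$ be the set of all $\omega\in\mathbb T$ such that $$\|k\omega\|\ \ge\ \frac{\gamma}{|k|\,\log^2(|k|+1)}\qquad\text{for all } k\in\mathbb Z\setminus\{0\}.$$ For $\omega\in\mathbb T$ let $S_\omega\colon\mathbb T^d\to\mathbb T^d$ be the affine skew product $$S_\omega(x_1,x_2,\dots,x_d)=(x_1+x_2,\;x_2+x_3,\;\dots,\;x_{d-1}+x_d,\;x_d+\omega).$$ For $0<\alpha\le 1$ let $C^\alpha(\mathbb T^d)$ be the space of $\alpha$-Hölder functions $\phi\colon\mathbb T^d\to\mathbb R$ with the norm $\|\phi\|_\alpha=\|\phi\|_\infty+\sup_{x\ne y}\frac{|\phi(x)-\phi(y)|}{|x-y|^\alpha}$. Put $\delta=2^{1-d}$. Then there are a sequence $\eta_N=\eta_N(d)\in\mathbb R$ with $\eta_N\to0$ as $N\to\infty$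 and, for every $\gamma>0$, a constant $C=C(d,\gamma)>0$ such that for all $\alpha\in(0,1]$, all $\phi\in C^\alpha(\mathbb T^d)$, all $\omega\in\mathrm{DC}(\mathbb T)_\gamma$ and all integers $N\ge1$, $$\Big\|\frac1N\sum_{j=0}^{N-1}\phi\circ S_\omega^j-\int_{\mathbb T^d}\phi\Big\|_\infty\ \le\ C\,\|\phi\|_\alpha\,N^{-\beta_N},\qquad \beta_N=\frac{\alpha\,\delta}{\delta+d}-\eta_N .$$ -/

import Mathlib

namespace SkewProduct

/-- The `d`-dimensional torus `(ℝ/ℤ)^d`. Its distance is the maximum over the coordinates of the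
distance in `ℝ/ℤ`, and its `volume` is the Haar probability measure. -/
abbrev Torus (d : ℕ) : Type := Fin d → UnitAddCircle

/-- The affine skew product
`(x₁, x₂, …, x_d) ↦ (x₁ + x₂, x₂ + x₃, …, x_{d-1} + x_d, x_d + ω)`. -/
def skewMap (d : ℕ) (ω : UnitAddCircle) (x : Torus d) : Torus d := fun i =>
  x i + if h : (i : ℕ) + 1 < d then x ⟨(i : ℕ) + 1, h⟩ else ω

/-- The frequencies `ω` with `‖kω‖ ≥ γ / (|k| log² (|k| + 1))` for every nonzero integer `k`.
The norm of `ℝ/ℤ` is the distance to the nearest integer. -/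
def DC (γ : ℝ) : Set UnitAddCircle :=
  {ω | ∀ k : ℤ, k ≠ 0 → γ / (|(k : ℝ)| * Real.log (|(k : ℝ)| + 1) ^ 2) ≤ ‖k • ω‖}

/-- The Hölder norm: the sup norm plus the Hölder seminorm (the least Hölder constant). -/
noncomputable def holderNorm {X : Type*} [MetricSpace X] [CompactSpace X] (α : NNReal)
    (φ : C(X, ℝ)) : ℝ :=
  ‖φ‖ + (nnHolderNorm α (φ : X → ℝ) : ℝ)

end SkewProduct

/-! ### Weyl differencing for polynomial phases. -/

namespace SkewProduct

open Finset ComplexConjugate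

/-! Along an orbit of the skew product, a character `mFourier k` becomes `e(f n)`, where `f` is a
polynomial phase with top difference `k i • ω` and `i` is the first index with `k i ≠ 0`. Weyl
differencing (`norm_sum_polyPhase_pow_le`) reduces its sum to a sum of `min (N, 1 / (2‖h₁⋯h_j k_i
ω‖))`. The divisor bound replaces the products `h₁⋯h_j` by single integers, and the Diophantine
condition spaces out any `N` consecutive multiples of `k i • ω`. With `δ = 2^(1-d)`, the normalized
sum is at most `C (|k_i|/N)^δ N^ε` (`exists_norm_sum_mFourier_iterate_le`).

A Hölder function is convolved with a product of Jackson kernels of degree `2M`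
(`exists_trigonometric_approximation`). The error is `O(M^(-α))`, and the coefficients are
`O(|k_i|^(-α))` for every nonzero `k_i`. Up to `N^ε`, the nonzero frequencies then contribute
`N^(-δ) M^(d+δ-α)`. The choice `M ≈ N^(δ/(δ+d))` makes this equal to the approximation error
`M^(-α)`, which is the exponent `αδ/(δ+d)`.

This holds for each fixed `ε` and `γ`. A diagonal choice, with both tending to zero slowly as `N`
grows, yields one sequence `η` that serves every `γ`. -/

theorem exists_real_rep_abs_le_half (x : UnitAddCircle) :
    ∃ t : ℝ, (t : UnitAddCircle) = x ∧ |t| ≤ 1 / 2 := by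
  induction x using QuotientAddGroup.induction_on with
  | H t =>
    refine ⟨t - round t, ?_, abs_sub_round t⟩
    rw [AddCircle.coe_sub, sub_eq_self]
    exact (AddCircle.coe_eq_zero_iff (1 : ℝ)).2 ⟨round t, by simp⟩

theorem four_mul_norm_le_norm_toCircle_sub_one (x : UnitAddCircle) :
    4 * ‖x‖ ≤ ‖(AddCircle.toCircle x : ℂ) - 1‖ := by
  obtain ⟨t, rfl, ht⟩ := exists_real_rep_abs_le_half x
  rw [AddCircle.toCircle_apply_mk, Circle.coe_exp,
    (AddCircle.norm_coe_eq_abs_iff (1 : ℝ) one_ne_zero).2 (by simpa using ht), mul_comm _ Complex.I,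
    Complex.norm_exp_I_mul_ofReal_sub_one, Real.norm_eq_abs, abs_mul, abs_two]
  have h1 : 2 / Real.pi * |2 * Real.pi / 1 * t / 2| ≤ |Real.sin (2 * Real.pi / 1 * t / 2)| := by
    refine Real.mul_abs_le_abs_sin ?_
    have : 2 * Real.pi / 1 * t / 2 = Real.pi * t := by ring
    rw [this, abs_mul, abs_of_pos Real.pi_pos]
    nlinarith [Real.pi_pos]
  have h2 : 2 / Real.pi * |2 * Real.pi / 1 * t / 2| = 2 * |t| := by
    have : 2 * Real.pi / 1 * t / 2 = Real.pi * t := by ring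
    rw [this, abs_mul, abs_of_pos Real.pi_pos]
    field_simp
  linarith

/-- `f` is a polynomial phase of degree at most `D` whose `D`-th finite difference is constantly
equal to `c`. -/
def IsPolyPhase {G : Type*} [AddCommGroup G] : ℕ → G → (ℕ → G) → Prop
  | 0, c, f => ∀ n, f n = c
  | D + 1, c, f => ∀ h : ℕ, IsPolyPhase D (h • c) fun n => f (n + h) - f n

/-- The minimum of `N` and `1 / (2 ‖c‖)`. -/
noncomputable def linearMajorant (N : ℕ) (c : UnitAddCircle) : ℝ := N / max 1 (2 * N * ‖c‖)

/-- The sum of `linearMajorant N (h₁ ⋯ h_j c)` over all `0 ≤ h₁, …, h_j < N`. -/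
noncomputable def weylMajorant : ℕ → ℕ → UnitAddCircle → ℝ
  | 0, N, c => linearMajorant N c
  | j + 1, N, c => ∑ h ∈ range N, weylMajorant j N (h • c)

theorem linearMajorant_nonneg (N : ℕ) (c : UnitAddCircle) : 0 ≤ linearMajorant N c := by
  unfold linearMajorant; positivity

theorem weylMajorant_nonneg (j N : ℕ) (c : UnitAddCircle) : 0 ≤ weylMajorant j N c := by
  induction j generalizing c with
  | zero => exact linearMajorant_nonneg N c
  | succ j ih => exact sum_nonneg fun h _ => ih _

theorem norm_sum_toCircle_le (s : Finset ℕ) (f : ℕ → UnitAddCircle) :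
    ‖∑ n ∈ s, (AddCircle.toCircle (f n) : ℂ)‖ ≤ s.card := by
  refine (norm_sum_le _ _).trans (le_of_eq ?_)
  simp only [Circle.norm_coe, sum_const, nsmul_eq_mul, mul_one]

/-- A geometric series: its closed form is at most `2 / ‖e(c) - 1‖`, and `‖e(c) - 1‖ ≥ 4‖c‖`.
Keeping the estimate in multiplied form avoids a separate case `c = 0`. -/
theorem norm_sum_linear_phase_le {c : UnitAddCircle} {f : ℕ → UnitAddCircle}
    (hf : IsPolyPhase 1 c f) {M N : ℕ} (hMN : M ≤ N) :
    ‖∑ n ∈ range M, (AddCircle.toCircle (f n) : ℂ)‖ ≤ linearMajorant N c := by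
  have hlin : ∀ n, f n = f 0 + n • c := fun n => by
    have := hf n 0
    simp only [zero_add] at this
    rw [← this]; abel
  have hS : ∑ n ∈ range M, (AddCircle.toCircle (f n) : ℂ)
      = AddCircle.toCircle (f 0) * ∑ n ∈ range M, (AddCircle.toCircle c : ℂ) ^ n := by
    rw [mul_sum]
    refine sum_congr rfl fun n _ => ?_
    rw [hlin, AddCircle.toCircle_add, AddCircle.toCircle_nsmul]
    simp
  have h1 : ‖∑ n ∈ range M, (AddCircle.toCircle (f n) : ℂ)‖ ≤ N :=
    (norm_sum_toCircle_le _ _).trans (by simpa using hMN)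
  have h2 : ‖∑ n ∈ range M, (AddCircle.toCircle (f n) : ℂ)‖ * (2 * ‖c‖) ≤ 1 := by
    have hg := geom_sum_mul (AddCircle.toCircle c : ℂ) M
    have hn := congrArg norm hg
    rw [norm_mul] at hn
    have hle : ‖(AddCircle.toCircle c : ℂ) ^ M - 1‖ ≤ 2 := by
      refine (norm_sub_le _ _).trans ?_
      rw [norm_pow, Circle.norm_coe, norm_one, one_pow]; norm_num
    rw [hS, norm_mul]
    simp only [Circle.norm_coe, one_mul]
    nlinarith [four_mul_norm_le_norm_toCircle_sub_one c,
      norm_nonneg (∑ n ∈ range M, (AddCircle.toCircle c : ℂ) ^ n)]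
  unfold linearMajorant
  rw [le_div_iff₀ (by positivity), mul_max_of_nonneg _ _ (norm_nonneg _)]
  refine max_le (by simpa using h1) ?_
  nlinarith [Nat.cast_nonneg (α := ℝ) N]

/-- Expanding the square and pairing `(m, n)` with `(n, m)` leaves twice the real part of the terms
with `n ≤ m`. The diagonal is then counted twice, which only increases the bound, and the lag `h = m
- n` groups the terms. -/
theorem norm_sq_sum_le_sum_correlations (z : ℕ → ℂ) (M : ℕ) :
    ‖∑ n ∈ range M, z n‖ ^ 2
      ≤ 2 * ∑ h ∈ range M, ‖∑ n ∈ range (M - h), z (n + h) * conj (z n)‖ := by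
  have key : ∀ M, ‖∑ n ∈ range M, z n‖ ^ 2
      ≤ 2 * (∑ m ∈ range M, z m * conj (∑ n ∈ range (m + 1), z n)).re := by
    intro M
    induction M with
    | zero => simp
    | succ M ih =>
      rw [sum_range_succ _ M, sum_range_succ _ M, Complex.add_re, ← Complex.normSq_eq_norm_sq,
        Complex.normSq_add]
      rw [← Complex.normSq_eq_norm_sq] at ih
      have h1 : z M * conj (∑ n ∈ range (M + 1), z n)
          = z M * conj (∑ n ∈ range M, z n) + (Complex.normSq (z M) : ℂ) := by
        rw [sum_range_succ, map_add, mul_add, Complex.mul_conj]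
      have h2 : (z M * conj (∑ n ∈ range M, z n)).re
          = ((∑ n ∈ range M, z n) * conj (z M)).re := by
        simp only [Complex.mul_re, Complex.conj_re, Complex.conj_im]; ring
      rw [h1, Complex.add_re, Complex.ofReal_re, h2]
      nlinarith [Complex.normSq_nonneg (z M)]
  have hflip : ∑ m ∈ range M, z m * conj (∑ n ∈ range (m + 1), z n)
      = ∑ h ∈ range M, ∑ n ∈ range (M - h), z (n + h) * conj (z n) := by
    rw [← sum_range_diag_flip M fun h n => z (n + h) * conj (z n)]
    refine sum_congr rfl fun m _ => ?_
    rw [map_sum, mul_sum, ← sum_range_reflect]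
    refine sum_congr rfl fun k hk => ?_
    rw [mem_range] at hk
    have h1 : m - k + k = m := by omega
    have h2 : m + 1 - 1 - k = m - k := by omega
    rw [h1, h2]
  refine (key M).trans ?_
  rw [hflip]
  gcongr
  exact (Complex.re_le_norm _).trans (norm_sum_le _ _)

/-- Weyl's inequality, before the evaluation of the majorant. -/
theorem norm_sum_polyPhase_pow_le (j : ℕ) {c : UnitAddCircle} {f : ℕ → UnitAddCircle}
    (hf : IsPolyPhase (j + 1) c f) {M N : ℕ} (hMN : M ≤ N) :
    ‖∑ n ∈ range M, (AddCircle.toCircle (f n) : ℂ)‖ ^ 2 ^ j * (N : ℝ) ^ (j + 1)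
      ≤ 2 ^ 2 ^ j * (N : ℝ) ^ 2 ^ j * weylMajorant j N c := by
  induction j generalizing c f M with
  | zero =>
    have := norm_sum_linear_phase_le hf hMN
    have h0 := linearMajorant_nonneg N c
    simp only [pow_zero, pow_one, zero_add, weylMajorant]
    nlinarith [Nat.cast_nonneg (α := ℝ) N,
      mul_le_mul_of_nonneg_right this (Nat.cast_nonneg (α := ℝ) N),
      mul_nonneg (Nat.cast_nonneg (α := ℝ) N) h0]
  | succ j ih =>
    set S : ℕ → ℝ := fun h =>
      ‖∑ n ∈ range (M - h), (AddCircle.toCircle (f (n + h) - f n) : ℂ)‖ with hSdef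
    have hS0 : ∀ h, 0 ≤ S h := fun h => norm_nonneg _
    have hsq : ‖∑ n ∈ range M, (AddCircle.toCircle (f n) : ℂ)‖ ^ 2 ≤ 2 * ∑ h ∈ range N, S h := by
      refine (norm_sq_sum_le_sum_correlations _ M).trans ?_
      gcongr
      refine le_trans (le_of_eq (sum_congr rfl fun h _ => ?_))
        (sum_le_sum_of_subset_of_nonneg (range_mono hMN) fun h _ _ => hS0 h)
      simp only [hSdef, sub_eq_add_neg, AddCircle.toCircle_add, AddCircle.toCircle_neg,
        Circle.coe_mul, Circle.coe_inv_eq_conj]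
    -- The power mean inequality with exponent `2 ^ j`, cleared of denominators, so that the
    -- inductive bound applies to each correlation separately.
    have hpm : (∑ h ∈ range N, S h) ^ 2 ^ j * N ≤ (N : ℝ) ^ 2 ^ j * ∑ h ∈ range N, S h ^ 2 ^ j := by
      obtain ⟨p, hp⟩ : ∃ p, 2 ^ j = p + 1 := ⟨2 ^ j - 1, (Nat.sub_add_cancel Nat.one_le_two_pow).symm⟩
      have h := pow_sum_div_card_le_sum_pow (s := range N) (f := S) (fun i _ => hS0 i) p
      rw [card_range] at h
      rw [hp]
      rcases Nat.eq_zero_or_pos N with rfl | hN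
      · simp
      · have hN' : (0 : ℝ) < N := by exact_mod_cast hN
        rw [div_le_iff₀ (by positivity)] at h
        calc _ ≤ ((∑ i ∈ range N, S i ^ (p + 1)) * N ^ p) * N := by gcongr
          _ = _ := by ring
    have hstep : ∀ h ∈ range N, S h ^ 2 ^ j * (N : ℝ) ^ (j + 1)
        ≤ 2 ^ 2 ^ j * (N : ℝ) ^ 2 ^ j * weylMajorant j N (h • c) := fun h _ =>
      ih (hf h) ((Nat.sub_le _ _).trans hMN)
    calc ‖∑ n ∈ range M, (AddCircle.toCircle (f n) : ℂ)‖ ^ 2 ^ (j + 1) * (N : ℝ) ^ (j + 1 + 1)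
        = (‖∑ n ∈ range M, (AddCircle.toCircle (f n) : ℂ)‖ ^ 2) ^ 2 ^ j * (N : ℝ) ^ (j + 2) := by
          rw [← pow_mul, pow_succ' 2 j]
      _ ≤ (2 * ∑ h ∈ range N, S h) ^ 2 ^ j * (N : ℝ) ^ (j + 2) := by gcongr
      _ = 2 ^ 2 ^ j * ((∑ h ∈ range N, S h) ^ 2 ^ j * N) * (N : ℝ) ^ (j + 1) := by
          rw [mul_pow]; ring
      _ ≤ 2 ^ 2 ^ j * ((N : ℝ) ^ 2 ^ j * ∑ h ∈ range N, S h ^ 2 ^ j) * (N : ℝ) ^ (j + 1) := by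
          gcongr
      _ = 2 ^ 2 ^ j * (N : ℝ) ^ 2 ^ j * ∑ h ∈ range N, S h ^ 2 ^ j * (N : ℝ) ^ (j + 1) := by
          rw [← sum_mul]; ring
      _ ≤ 2 ^ 2 ^ j * (N : ℝ) ^ 2 ^ j *
          ∑ h ∈ range N, 2 ^ 2 ^ j * (N : ℝ) ^ 2 ^ j * weylMajorant j N (h • c) := by
          exact mul_le_mul_of_nonneg_left (sum_le_sum hstep) (by positivity)
      _ = _ := by
          rw [← mul_sum, weylMajorant, pow_succ' 2 j, two_mul, pow_add, pow_add]; ring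

end SkewProduct

/-! ### The divisor bound and the spacing of multiples. -/

namespace SkewProduct

open Finset

/-- The factor of the divisor function at one prime, with a constant uniform in the prime and the
exponent: `2^(aε) ≥ 1 + ε a log 2`. -/
theorem add_one_le_mul_rpow_of_two_le {ε : ℝ} (hε : 0 < ε) (a : ℕ) {p : ℝ} (hp : 2 ≤ p) :
    (a : ℝ) + 1 ≤ max 1 (1 / (ε * Real.log 2)) * (p ^ a) ^ ε := by
  have hl : 0 < Real.log 2 := Real.log_pos one_lt_two
  have h1 : 1 + ε * Real.log 2 * a ≤ ((2 : ℝ) ^ a) ^ ε := by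
    have : ((2 : ℝ) ^ a) ^ ε = Real.exp (ε * Real.log 2 * a) := by
      rw [← Real.rpow_natCast, ← Real.rpow_mul zero_le_two, Real.rpow_def_of_pos two_pos]
      ring_nf
    rw [this, add_comm]
    exact Real.add_one_le_exp _
  have h2 : ((2 : ℝ) ^ a) ^ ε ≤ (p ^ a) ^ ε := by gcongr
  set A := max 1 (1 / (ε * Real.log 2)) with hA
  have hA1 : 1 ≤ A := le_max_left _ _
  have hA2 : 1 ≤ A * (ε * Real.log 2) := by
    have : 1 / (ε * Real.log 2) ≤ A := le_max_right _ _
    rwa [div_le_iff₀ (by positivity)] at this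
  calc (a : ℝ) + 1 ≤ A * (ε * Real.log 2) * a + A := by
        gcongr; exact le_mul_of_one_le_left (by positivity) hA2
    _ = A * (1 + ε * Real.log 2 * a) := by ring
    _ ≤ _ := by gcongr; exact h1.trans h2

/-- The divisor bound: the number of divisors of `n` is `O(n ^ ε)`. -/
theorem exists_card_divisors_le_mul_rpow {ε : ℝ} (hε : 0 < ε) :
    ∃ C : ℝ, 1 ≤ C ∧ ∀ n : ℕ, n ≠ 0 → (n.divisors.card : ℝ) ≤ C * (n : ℝ) ^ ε := by
  set A := max 1 (1 / (ε * Real.log 2)) with hA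
  have hA1 : 1 ≤ A := le_max_left _ _
  -- From `P` on, `p ^ ε ≥ 2`, so `a + 1 ≤ 2 ^ a ≤ p ^ (aε)` costs no constant. Only the primes
  -- below `P` lose a factor `A`.
  set P := ⌈(2 : ℝ) ^ (1 / ε)⌉₊ with hP
  refine ⟨A ^ P, one_le_pow₀ hA1, fun n hn => ?_⟩
  have hn_eq : (n : ℝ) ^ ε = ∏ p ∈ n.primeFactors, ((p : ℝ) ^ n.factorization p) ^ ε := by
    rw [Real.finsetProd_rpow _ _ fun p _ => by positivity]
    congr 1
    conv_lhs => rw [← Nat.prod_factorization_pow_eq_self hn]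
    rw [Finsupp.prod, Nat.support_factorization]
    push_cast
    rfl
  have hlocal : ∀ p ∈ n.primeFactors, ((n.factorization p : ℝ) + 1)
      ≤ (if p < P then A else 1) * ((p : ℝ) ^ n.factorization p) ^ ε := by
    intro p hp
    have hp2 : (2 : ℝ) ≤ p := by exact_mod_cast (Nat.prime_of_mem_primeFactors hp).two_le
    split_ifs with h
    · exact add_one_le_mul_rpow_of_two_le hε _ hp2
    · have h3 : (2 : ℝ) ^ (1 / ε) ≤ p := (Nat.le_ceil _).trans (by exact_mod_cast not_lt.1 h)
      have h4 : (2 : ℝ) ≤ (p : ℝ) ^ ε := by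
        calc (2 : ℝ) = ((2 : ℝ) ^ (1 / ε)) ^ ε := by
              rw [← Real.rpow_mul zero_le_two, one_div_mul_cancel hε.ne', Real.rpow_one]
          _ ≤ _ := by gcongr
      rw [one_mul, ← Real.rpow_natCast, ← Real.rpow_mul (by positivity), mul_comm,
        Real.rpow_mul (by positivity), Real.rpow_natCast]
      calc ((n.factorization p : ℝ) + 1) ≤ (2 : ℝ) ^ n.factorization p := by
            exact_mod_cast Nat.lt_two_pow_self
        _ ≤ _ := by gcongr
  have hcard : ∏ p ∈ n.primeFactors, (if p < P then A else 1) ≤ A ^ P := by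
    rw [prod_ite, prod_const_one, mul_one, prod_const]
    refine pow_le_pow_right₀ hA1 ?_
    calc _ ≤ (range P).card := card_le_card fun p hp => by
            simpa using (mem_filter.1 hp).2
      _ = P := card_range P
  rw [Nat.card_divisors hn, hn_eq]
  push_cast
  calc _ ≤ ∏ p ∈ n.primeFactors,
        ((if p < P then A else 1) * ((p : ℝ) ^ n.factorization p) ^ ε) :=
        prod_le_prod (fun _ _ => by positivity) hlocal
    _ ≤ _ := by
        rw [prod_mul_distrib]
        gcongr

/-- A given `l` is a product `h * m` in at most as many ways as it has divisors, since `h`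
determines `m`. -/
theorem sum_sum_mul_le_of_card_divisors_le {G : ℕ → ℝ} (hG : ∀ n, 0 ≤ G n) {B : ℝ} {N M : ℕ}
    (hB : ∀ l ∈ Icc 1 (N * M), (l.divisors.card : ℝ) ≤ B) :
    ∑ h ∈ Icc 1 N, ∑ m ∈ Icc 1 M, G (h * m) ≤ B * ∑ l ∈ Icc 1 (N * M), G l := by
  rw [← sum_product' (f := fun h m => G (h * m))]
  have hmaps : ∀ p ∈ Icc 1 N ×ˢ Icc 1 M, p.1 * p.2 ∈ Icc 1 (N * M) := by
    intro p hp
    simp only [mem_product, mem_Icc] at hp ⊢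
    exact ⟨Nat.mul_pos hp.1.1 hp.2.1, Nat.mul_le_mul hp.1.2 hp.2.2⟩
  rw [← sum_fiberwise_of_maps_to hmaps, mul_sum]
  refine sum_le_sum fun l hl => ?_
  have h1 : ∑ p ∈ Icc 1 N ×ˢ Icc 1 M with p.1 * p.2 = l, G (p.1 * p.2)
      = #{p ∈ Icc 1 N ×ˢ Icc 1 M | p.1 * p.2 = l} * G l := by
    rw [← nsmul_eq_mul, ← sum_const]
    exact sum_congr rfl fun p hp => by rw [(mem_filter.1 hp).2]
  have h2 : #{p ∈ Icc 1 N ×ˢ Icc 1 M | p.1 * p.2 = l} ≤ l.divisors.card := by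
    refine card_le_card_of_injOn Prod.fst (fun p hp => ?_) fun p hp q hq hpq => ?_
    · have hp := mem_filter.1 hp
      have hl := (mem_Icc.1 hl).1
      exact Nat.mem_divisors.2 ⟨⟨p.2, hp.2.symm⟩, by omega⟩
    · have hp := mem_filter.1 hp
      have hq := mem_filter.1 hq
      have h0 : 0 < p.1 := (mem_Icc.1 (mem_product.1 hp.1).1).1
      refine Prod.ext hpq (Nat.eq_of_mul_eq_mul_left h0 ?_)
      rw [hp.2, hpq, hq.2]
  rw [h1]
  refine mul_le_mul_of_nonneg_right (le_trans ?_ (hB l hl)) (hG l)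
  exact_mod_cast h2

theorem linearMajorant_le (N : ℕ) (c : UnitAddCircle) : linearMajorant N c ≤ N :=
  div_le_self (Nat.cast_nonneg N) (le_max_left _ _)

theorem weylMajorant_le_pow (j N : ℕ) (c : UnitAddCircle) :
    weylMajorant j N c ≤ (N : ℝ) ^ (j + 1) := by
  induction j generalizing c with
  | zero => simpa [weylMajorant] using linearMajorant_le N c
  | succ j ih =>
    calc weylMajorant (j + 1) N c ≤ ∑ _h ∈ range N, (N : ℝ) ^ (j + 1) := sum_le_sum fun h _ => ih _
      _ = _ := by rw [sum_const, card_range, nsmul_eq_mul]; ring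

/-- Each differencing variable is merged into the product at the cost of one factor `B`. The tuples
containing a zero are bounded trivially and make up the first term. The exponent `J` is kept apart
from `j` so that one divisor bound serves the whole induction. -/
theorem weylMajorant_le_sum_linearMajorant {N J : ℕ} {B : ℝ} (hB1 : 1 ≤ B)
    (hB : ∀ l ∈ Icc 1 (N ^ J), (l.divisors.card : ℝ) ≤ B) (hN : 1 ≤ N) (j : ℕ) (hj : j ≤ J)
    (c : UnitAddCircle) :
    weylMajorant j N c ≤ j * (N : ℝ) ^ j +
      B ^ j * ∑ m ∈ Icc 1 (N ^ j), linearMajorant N (m • c) := by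
  induction j generalizing c with
  | zero => simp [weylMajorant]
  | succ j ih =>
    have hsub : range N ⊆ insert 0 (Icc 1 N) := fun h hh => by
      simp only [mem_insert, mem_Icc, mem_range] at hh ⊢; omega
    have hnn : ∀ m : ℕ, 0 ≤ linearMajorant N (m • c) := fun m => linearMajorant_nonneg _ _
    calc weylMajorant (j + 1) N c
        ≤ ∑ h ∈ insert 0 (Icc 1 N), weylMajorant j N (h • c) :=
          sum_le_sum_of_subset_of_nonneg hsub fun h _ _ => weylMajorant_nonneg _ _ _
      _ = weylMajorant j N (0 • c) + ∑ h ∈ Icc 1 N, weylMajorant j N (h • c) :=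
          sum_insert (by simp)
      _ ≤ (N : ℝ) ^ (j + 1) + ∑ h ∈ Icc 1 N, (j * (N : ℝ) ^ j +
            B ^ j * ∑ m ∈ Icc 1 (N ^ j), linearMajorant N ((h * m) • c)) := by
          refine add_le_add (weylMajorant_le_pow _ _ _) (sum_le_sum fun h _ => ?_)
          refine (ih (by omega) (h • c)).trans (le_of_eq ?_)
          simp only [smul_smul, mul_comm h]
      _ = (j + 1 : ℕ) * (N : ℝ) ^ (j + 1) + B ^ j *
            ∑ h ∈ Icc 1 N, ∑ m ∈ Icc 1 (N ^ j), linearMajorant N ((h * m) • c) := by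
          rw [sum_add_distrib, sum_const, Nat.card_Icc, nsmul_eq_mul, ← mul_sum]
          push_cast [Nat.add_sub_cancel]
          ring
      _ ≤ (j + 1 : ℕ) * (N : ℝ) ^ (j + 1) + B ^ j *
            (B * ∑ l ∈ Icc 1 (N ^ (j + 1)), linearMajorant N (l • c)) := by
          have := sum_sum_mul_le_of_card_divisors_le (G := fun l => linearMajorant N (l • c)) hnn
            (N := N) (M := N ^ j) (B := B) fun l hl => hB l (mem_Icc.2
              ⟨(mem_Icc.1 hl).1, (mem_Icc.1 hl).2.trans (by
                rw [← pow_succ']; exact Nat.pow_le_pow_right hN hj)⟩)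
          rw [← pow_succ'] at this
          gcongr
      _ = _ := by rw [pow_succ]; ring

/-- With `[0, 1]` cut into cells of length `s`, each cell receives at most one `‖m • c‖`. Cell `0`
contributes at most `N` and cell `r ≥ 1` at most `1 / (2 s r)`, leaving a harmonic sum. -/
theorem sum_le_of_injOn_scale {N : ℕ} {s : ℝ} (hs : 0 < s) (hs1 : s ≤ 1) (A : Finset ℕ)
    (c : UnitAddCircle)
    (hinj : Set.InjOn (fun m : ℕ => ⌊‖m • c‖ / s⌋₊) A) :
    ∑ m ∈ A, linearMajorant N (m • c) ≤ N + 1 / (2 * s) * (1 + Real.log (1 / s)) := by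
  set L := ⌊1 / s⌋₊ with hL
  set F : ℕ → ℝ := fun r => if r = 0 then N else 1 / (2 * s) * (r : ℝ)⁻¹ with hF
  have hF0 : ∀ r, 0 ≤ F r := fun r => by simp only [hF]; split_ifs <;> positivity
  have hle : ∀ m : ℕ, linearMajorant N (m • c) ≤ F ⌊‖m • c‖ / s⌋₊ := by
    intro m
    simp only [hF]
    split_ifs with h
    · exact linearMajorant_le _ _
    · have h1 : (⌊‖m • c‖ / s⌋₊ : ℝ) * s ≤ ‖m • c‖ := by
        rw [← le_div_iff₀ hs]; exact Nat.floor_le (by positivity)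
      have h2 : (0 : ℝ) < ⌊‖m • c‖ / s⌋₊ := by exact_mod_cast Nat.pos_of_ne_zero h
      rw [← one_div, one_div_mul_one_div, linearMajorant,
        div_le_div_iff₀ (by positivity) (by positivity), one_mul]
      refine le_trans ?_ (le_max_right _ _)
      nlinarith [Nat.cast_nonneg (α := ℝ) N]
  have hmem : ∀ m ∈ A, ⌊‖m • c‖ / s⌋₊ ∈ range (L + 1) := fun m _ => by
    rw [mem_range, Nat.lt_succ_iff]
    refine Nat.floor_le_floor ?_
    gcongr
    have := AddCircle.norm_le_half_period (1 : ℝ) (x := m • c) one_ne_zero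
    rw [abs_one] at this
    linarith
  calc ∑ m ∈ A, linearMajorant N (m • c) ≤ ∑ m ∈ A, F ⌊‖m • c‖ / s⌋₊ := sum_le_sum fun m _ => hle m
    _ = ∑ r ∈ A.image fun m => ⌊‖m • c‖ / s⌋₊, F r := (sum_image hinj).symm
    _ ≤ ∑ r ∈ range (L + 1), F r :=
        sum_le_sum_of_subset_of_nonneg (image_subset_iff.2 hmem) fun r _ _ => hF0 r
    _ = N + 1 / (2 * s) * (harmonic L : ℝ) := by
        rw [sum_range_succ', add_comm, harmonic, Rat.cast_sum, mul_sum]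
        simp [hF]
    _ ≤ _ := by
        gcongr
        refine (harmonic_le_one_add_log L).trans (add_le_add_right ?_ 1)
        rcases Nat.eq_zero_or_pos L with h | h
        · rw [h]; simp only [Nat.cast_zero, Real.log_zero]
          exact Real.log_nonneg ((one_le_div hs).2 hs1)
        · exact Real.log_le_log (by exact_mod_cast h) (Nat.floor_le (by positivity))

/-- Two indices of a block differ by some `h < N`, so the representatives of the multiples are
`s`-separated. Taking norms folds `t` onto `-t`, hence the split by sign into two families with one
point per cell. -/
theorem sum_Ico_linearMajorant_le {N : ℕ} {s : ℝ} (hs : 0 < s) (hs1 : s ≤ 1) (c : UnitAddCircle)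
    (hsep : ∀ h : ℕ, 1 ≤ h → h < N → s ≤ ‖h • c‖) (a : ℕ) :
    ∑ m ∈ Ico a (a + N), linearMajorant N (m • c)
      ≤ 2 * N + 1 / s * (1 + Real.log (1 / s)) := by
  choose t ht hth using fun m : ℕ => exists_real_rep_abs_le_half (m • c)
  have hnorm : ∀ m, ‖m • c‖ = |t m| := fun m => by
    rw [← ht m]
    exact (AddCircle.norm_coe_eq_abs_iff (1 : ℝ) one_ne_zero).2 (by simpa using hth m)
  have hdist : ∀ m m', m ∈ Ico a (a + N) → m' ∈ Ico a (a + N) → m < m' →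
      s ≤ |t m' - t m| := by
    intro m m' hm hm' hlt
    rw [mem_Ico] at hm hm'
    refine (hsep (m' - m) (by omega) (by omega)).trans ?_
    have : (m' - m) • c = ((t m' - t m : ℝ) : UnitAddCircle) := by
      rw [AddCircle.coe_sub, ht, ht, sub_nsmul _ hlt.le, sub_eq_add_neg]
    rw [this]
    exact QuotientAddGroup.norm_mk_le_norm
  have hfl : ∀ x y : ℝ, 0 ≤ x → 0 ≤ y → ⌊x / s⌋₊ = ⌊y / s⌋₊ → |x - y| < s := by
    intro x y hx hy h
    have h1 := Nat.floor_le (div_nonneg hx hs.le)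
    have h2 := Nat.lt_floor_add_one (x / s)
    have h3 := Nat.floor_le (div_nonneg hy hs.le)
    have h4 := Nat.lt_floor_add_one (y / s)
    rw [h] at h1 h2
    have : |x / s - y / s| < 1 := by rw [abs_lt]; constructor <;> linarith
    rwa [← sub_div, abs_div, abs_of_pos hs, div_lt_one hs] at this
  have hinj : ∀ A : Finset ℕ, A ⊆ Ico a (a + N) →
      (∀ m ∈ A, ∀ m' ∈ A, |(|t m'| - |t m|)| = |t m' - t m|) →
      Set.InjOn (fun m : ℕ => ⌊‖m • c‖ / s⌋₊) A := by
    intro A hA hsign m hm m' hm' h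
    simp only [hnorm] at h
    have hlt := hfl _ _ (abs_nonneg _) (abs_nonneg _) h
    rw [hsign m' hm' m hm] at hlt
    rcases lt_trichotomy m m' with h' | h' | h'
    · have := hdist m m' (hA hm) (hA hm') h'
      rw [abs_sub_comm] at this; linarith
    · exact h'
    · have := hdist m' m (hA hm') (hA hm) h'
      linarith
  rw [← sum_filter_add_sum_filter_not _ fun m => 0 ≤ t m]
  have e1 := sum_le_of_injOn_scale (N := N) hs hs1 _ c
    (hinj ((Ico a (a + N)).filter fun m => 0 ≤ t m) (filter_subset _ _) fun m hm m' hm' => by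
      rw [abs_of_nonneg (mem_filter.1 hm).2, abs_of_nonneg (mem_filter.1 hm').2])
  have e2 := sum_le_of_injOn_scale (N := N) hs hs1 _ c
    (hinj ((Ico a (a + N)).filter fun m => ¬ 0 ≤ t m) (filter_subset _ _) fun m hm m' hm' => by
      rw [abs_of_neg (not_le.1 (mem_filter.1 hm).2), abs_of_neg (not_le.1 (mem_filter.1 hm').2),
        ← abs_neg]
      congr 1; ring)
  have e3 : 1 / s = 2 * (1 / (2 * s)) := by field_simp
  have e4 : 1 / s * (1 + Real.log (1 / s)) = 2 * (1 / (2 * s) * (1 + Real.log (1 / s))) := by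
    rw [← mul_assoc, ← e3]
  rw [e4]
  linarith

theorem sum_Icc_mul_linearMajorant_le {N : ℕ} {s : ℝ} (hs : 0 < s) (hs1 : s ≤ 1)
    (c : UnitAddCircle) (hsep : ∀ h : ℕ, 1 ≤ h → h < N → s ≤ ‖h • c‖) (Q : ℕ) :
    ∑ m ∈ Icc 1 (Q * N), linearMajorant N (m • c)
      ≤ Q * (2 * N + 1 / s * (1 + Real.log (1 / s))) := by
  have hIcc : ∀ n, Icc 1 n = Ico 1 (1 + n) := fun n => by ext; simp; omega
  rw [hIcc]
  induction Q with
  | zero => simp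
  | succ Q ih =>
    have h := sum_Ico_linearMajorant_le hs hs1 c hsep (1 + Q * N)
    rw [← sum_Ico_consecutive _ (show 1 ≤ 1 + Q * N by omega)
      (show 1 + Q * N ≤ 1 + (Q + 1) * N by nlinarith)]
    have : 1 + (Q + 1) * N = 1 + Q * N + N := by ring
    rw [this]
    push_cast
    linarith

end SkewProduct

/-! ### The Diophantine condition and Weyl's bound. -/

namespace SkewProduct

open Finset

theorem exists_le_norm_zsmul_of_mem_DC {γ ε : ℝ} (hγ : 0 < γ) (hε : 0 < ε) :
    ∃ c : ℝ, 0 < c ∧ c ≤ 1 ∧ ∀ ω ∈ DC γ, ∀ k : ℤ, k ≠ 0 →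
      c / |(k : ℝ)| ^ (1 + ε) ≤ ‖k • ω‖ := by
  refine ⟨min 1 (γ * ε ^ 2 / (4 * 2 ^ ε)), by positivity, min_le_left _ _, fun ω hω k hk => ?_⟩
  refine le_trans ?_ (hω k hk)
  have hx : (1 : ℝ) ≤ |(k : ℝ)| := by exact_mod_cast Int.one_le_abs hk
  set x := |(k : ℝ)|
  have hlog0 : 0 < Real.log (x + 1) := Real.log_pos (by linarith)
  have hlog : Real.log (x + 1) ≤ (2 * x) ^ (ε / 2) / (ε / 2) :=
    (Real.log_le_log (by linarith) (by linarith)).trans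
      (Real.log_le_rpow_div (by linarith) (by positivity))
  have hsq : Real.log (x + 1) ^ 2 ≤ 4 * 2 ^ ε / ε ^ 2 * x ^ ε := by
    calc Real.log (x + 1) ^ 2 ≤ ((2 * x) ^ (ε / 2) / (ε / 2)) ^ 2 := by gcongr
      _ = ((2 * x) ^ (ε / 2)) ^ 2 * 4 / ε ^ 2 := by field_simp; ring
      _ = (2 * x) ^ ε * 4 / ε ^ 2 := by
          rw [← Real.rpow_natCast, ← Real.rpow_mul (by positivity)]
          norm_num
      _ = _ := by rw [Real.mul_rpow zero_le_two (by positivity)]; ring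
  calc min 1 (γ * ε ^ 2 / (4 * 2 ^ ε)) / x ^ (1 + ε)
      ≤ γ * ε ^ 2 / (4 * 2 ^ ε) / x ^ (1 + ε) := by gcongr; exact min_le_right _ _
    _ = γ / (x * (4 * 2 ^ ε / ε ^ 2 * x ^ ε)) := by
        rw [Real.rpow_add (by positivity), Real.rpow_one]; field_simp
    _ ≤ _ := by gcongr

theorem linearMajorant_mul_norm_le (N : ℕ) (c : UnitAddCircle) :
    linearMajorant N c * ‖c‖ ≤ 1 := by
  rw [linearMajorant, div_mul_eq_mul_div, div_le_one (by positivity)]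
  refine le_trans ?_ (le_max_right _ _)
  nlinarith [mul_nonneg (Nat.cast_nonneg (α := ℝ) N) (norm_nonneg c)]

/-- This bounds `s⁻¹ (1 + log s⁻¹)` for the spacing `s = c / (N x)^(1+ε)`. The factor `N x` is kept
exactly. Of the loss `6ε`, `2ε` comes from `(N x)^ε` and `4ε` from the logarithm. -/
theorem mul_one_add_log_le {c ε x N : ℝ} (hc : 0 < c) (hc1 : c ≤ 1) (hε : 0 < ε) (hε1 : ε ≤ 1)
    (hx : 1 ≤ x) (hxN : x ≤ N) :
    (N * x) ^ (1 + ε) / c * (1 + Real.log ((N * x) ^ (1 + ε) / c))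
      ≤ 1 / c * (1 + 1 / (c * ε)) * (N * x * N ^ (6 * ε)) := by
  have hN : 1 ≤ N := hx.trans hxN
  set y := (N * x) ^ (1 + ε) / c with hy
  have hy0 : 0 < y := by positivity
  have hNx : N * x ≤ N ^ 2 := by nlinarith
  have hNx1 : 1 ≤ N * x := by nlinarith
  have h1 : y ≤ 1 / c * (N * x * N ^ (2 * ε)) := by
    rw [hy, Real.rpow_add (by positivity), Real.rpow_one]
    have : (N * x) ^ ε ≤ N ^ (2 * ε) := by
      calc (N * x) ^ ε ≤ (N ^ 2) ^ ε := by gcongr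
        _ = _ := by rw [← Real.rpow_natCast, ← Real.rpow_mul (by positivity)]; norm_num
    calc _ = 1 / c * (N * x * (N * x) ^ ε) := by ring
      _ ≤ _ := by gcongr
  have h2 : y ≤ N ^ (4 : ℝ) / c := by
    rw [hy]
    gcongr
    calc (N * x) ^ (1 + ε) ≤ (N * x) ^ (2 : ℝ) := by
          apply Real.rpow_le_rpow_of_exponent_le hNx1; linarith
      _ ≤ (N ^ 2) ^ (2 : ℝ) := by gcongr
      _ = _ := by rw [← Real.rpow_natCast, ← Real.rpow_mul (by positivity)]; norm_num
  have h3 : y ^ ε ≤ N ^ (4 * ε) / c := by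
    calc y ^ ε ≤ (N ^ (4 : ℝ) / c) ^ ε := by gcongr
      _ = N ^ (4 * ε) / c ^ ε := by
          rw [Real.div_rpow (by positivity) hc.le, ← Real.rpow_mul (by positivity)]
      _ ≤ _ := by
          gcongr
          calc c = c ^ (1 : ℝ) := (Real.rpow_one c).symm
            _ ≤ _ := Real.rpow_le_rpow_of_exponent_ge hc hc1 hε1
  have h4 : 1 + Real.log y ≤ (1 + 1 / (c * ε)) * N ^ (4 * ε) := by
    have hlog := Real.log_le_rpow_div hy0.le hε
    have hN4 : 1 ≤ N ^ (4 * ε) := Real.one_le_rpow hN (by positivity)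
    calc 1 + Real.log y ≤ N ^ (4 * ε) + N ^ (4 * ε) / c / ε := by
          gcongr
          exact hlog.trans (by gcongr)
      _ = _ := by field_simp
  calc y * (1 + Real.log y) ≤ y * ((1 + 1 / (c * ε)) * N ^ (4 * ε)) := by gcongr
    _ ≤ (1 / c * (N * x * N ^ (2 * ε))) * ((1 + 1 / (c * ε)) * N ^ (4 * ε)) := by gcongr
    _ = 1 / c * (1 + 1 / (c * ε)) * (N * x * (N ^ (2 * ε) * N ^ (4 * ε))) := by ring
    _ = _ := by rw [← Real.rpow_add (by positivity)]; ring_nf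

theorem exists_sum_linearMajorant_zsmul_le {γ ε : ℝ} (hγ : 0 < γ) (hε : 0 < ε) (hε1 : ε ≤ 1) :
    ∃ C : ℝ, 1 ≤ C ∧ ∀ ω ∈ DC γ, ∀ k : ℤ, k ≠ 0 → ∀ N : ℕ, |(k : ℝ)| ≤ N → ∀ j : ℕ,
      ∑ m ∈ Icc 1 (N ^ j), linearMajorant N (m • k • ω)
        ≤ C * ((N : ℝ) ^ j * |(k : ℝ)| * (N : ℝ) ^ (6 * ε)) := by
  obtain ⟨c, hc, hc1, hdio⟩ := exists_le_norm_zsmul_of_mem_DC hγ hε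
  set A := 1 / c * (1 + 1 / (c * ε)) with hA
  have hA0 : 0 < A := by positivity
  have hcA : 1 / c ≤ A := le_mul_of_one_le_right (by positivity)
    (le_add_of_nonneg_right (by positivity))
  refine ⟨2 + A, by linarith, fun ω hω k hk N hkN j => ?_⟩
  have hx : (1 : ℝ) ≤ |(k : ℝ)| := by exact_mod_cast Int.one_le_abs hk
  set x := |(k : ℝ)| with hxdef
  have hN : (1 : ℝ) ≤ N := hx.trans hkN
  have hN6 : (1 : ℝ) ≤ (N : ℝ) ^ (6 * ε) := Real.one_le_rpow hN (by positivity)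
  -- For `j = 0` there is a single multiple, and the block estimate would lose a factor `N`; the
  -- Diophantine bound at `k` is used directly. Otherwise the range consists of `N ^ j` blocks of
  -- length `N` (with `j` now the predecessor).
  cases j with
  | zero =>
    simp only [pow_zero, Icc_self, sum_singleton, one_smul, one_mul]
    have h1 := hdio ω hω k hk
    have h2 := linearMajorant_mul_norm_le N (k • ω)
    have h3 : linearMajorant N (k • ω) ≤ x ^ (1 + ε) / c := by
      have h4 := mul_le_mul_of_nonneg_left h1 (linearMajorant_nonneg N (k • ω))
      have h5 : linearMajorant N (k • ω) * (c / x ^ (1 + ε)) ≤ 1 := h4.trans h2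
      rw [le_div_iff₀ hc]
      rwa [← mul_div_assoc, div_le_one (by positivity)] at h5
    calc linearMajorant N (k • ω) ≤ x ^ (1 + ε) / c := h3
      _ = 1 / c * (x * x ^ ε) := by rw [Real.rpow_add (by positivity), Real.rpow_one]; ring
      _ ≤ (2 + A) * (x * (N : ℝ) ^ (6 * ε)) := by
          gcongr
          · linarith
          · calc x ^ ε ≤ (N : ℝ) ^ ε := by gcongr
              _ ≤ _ := Real.rpow_le_rpow_of_exponent_le hN (by linarith)
  | succ j =>
    have hNx : 1 ≤ (N : ℝ) * x := by nlinarith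
    set s := c / ((N : ℝ) * x) ^ (1 + ε) with hs
    have hs0 : 0 < s := by positivity
    have hs1 : s ≤ 1 := by
      rw [hs, div_le_one (by positivity)]
      exact hc1.trans (Real.one_le_rpow hNx (by positivity))
    have hsep : ∀ h : ℕ, 1 ≤ h → h < N → s ≤ ‖h • k • ω‖ := by
      intro h h1 hN
      have e1 : h • k • ω = ((h : ℤ) * k) • ω := by
        rw [mul_smul, natCast_zsmul]
      have h1' : (1 : ℝ) ≤ h := by exact_mod_cast h1
      have hN' : (h : ℝ) ≤ N := by exact_mod_cast hN.le
      rw [e1]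
      refine le_trans ?_ (hdio ω hω _ (mul_ne_zero (by omega) hk))
      push_cast
      rw [abs_mul, Nat.abs_cast, hs]
      gcongr
    have h1 := sum_Icc_mul_linearMajorant_le hs0 hs1 (k • ω) hsep (N ^ j)
    have h2 := mul_one_add_log_le hc hc1 hε hε1 hx hkN
    have h3 : 1 / s = ((N : ℝ) * x) ^ (1 + ε) / c := by rw [hs, one_div_div]
    rw [h3] at h1
    rw [pow_succ]
    refine h1.trans ?_
    push_cast
    have h4 : (N : ℝ) ≤ N * x * (N : ℝ) ^ (6 * ε) := by
      rw [mul_assoc]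
      exact le_mul_of_one_le_right (by positivity) (one_le_mul_of_one_le_of_one_le hx hN6)
    calc _ ≤ (N : ℝ) ^ j * (2 * (N * x * (N : ℝ) ^ (6 * ε)) + A * (N * x * (N : ℝ) ^ (6 * ε))) := by
          gcongr
      _ = _ := by ring

theorem exists_weylMajorant_zsmul_le (j : ℕ) {γ ε : ℝ} (hγ : 0 < γ) (hε : 0 < ε) :
    ∃ C : ℝ, 1 ≤ C ∧ ∀ ω ∈ DC γ, ∀ k : ℤ, k ≠ 0 → ∀ N : ℕ, |(k : ℝ)| ≤ N →
      weylMajorant j N (k • ω) ≤ C * ((N : ℝ) ^ j * |(k : ℝ)| * (N : ℝ) ^ ε) := by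
  -- The divisor bound on integers up to `N ^ j`, raised to the power `j`, loses `j² ε'`; the
  -- spacing estimate loses `6 ε'`.
  set ε' := min 1 (ε / ((j : ℝ) ^ 2 + 6)) with hε'
  have hε'0 : 0 < ε' := by positivity
  have hε'1 : ((j : ℝ) ^ 2 + 6) * ε' ≤ ε := by
    have : ε' ≤ ε / ((j : ℝ) ^ 2 + 6) := min_le_right _ _
    rw [le_div_iff₀ (by positivity)] at this
    linarith
  obtain ⟨C, hC, hsum⟩ := exists_sum_linearMajorant_zsmul_le hγ hε'0 (min_le_left _ _)
  obtain ⟨T, hT, hdiv⟩ := exists_card_divisors_le_mul_rpow hε'0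
  refine ⟨j + T ^ j * C, ?_, fun ω hω k hk N hkN => ?_⟩
  · have := one_le_mul_of_one_le_of_one_le (one_le_pow₀ hT (n := j)) hC
    have := Nat.cast_nonneg (α := ℝ) j
    linarith
  have hx : (1 : ℝ) ≤ |(k : ℝ)| := by exact_mod_cast Int.one_le_abs hk
  set x := |(k : ℝ)| with hxdef
  have hN : (1 : ℝ) ≤ N := hx.trans hkN
  have hN1 : 1 ≤ N := by exact_mod_cast hN
  set B := T * (N : ℝ) ^ (j * ε') with hB
  have hB1 : 1 ≤ B := one_le_mul_of_one_le_of_one_le hT (Real.one_le_rpow hN (by positivity))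
  have hBdiv : ∀ l ∈ Icc 1 (N ^ j), (l.divisors.card : ℝ) ≤ B := by
    intro l hl
    rw [mem_Icc] at hl
    refine (hdiv l (by omega)).trans ?_
    have hl' : (l : ℝ) ≤ (N : ℝ) ^ j := by exact_mod_cast hl.2
    rw [hB, Real.rpow_mul (by positivity), Real.rpow_natCast]
    gcongr
  have hw := weylMajorant_le_sum_linearMajorant hB1 hBdiv hN1 j le_rfl (k • ω)
  have hBj : B ^ j = T ^ j * (N : ℝ) ^ ((j : ℝ) ^ 2 * ε') := by
    rw [hB, mul_pow, ← Real.rpow_natCast ((N : ℝ) ^ _), ← Real.rpow_mul (by positivity)]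
    ring_nf
  have hNe : 1 ≤ x * (N : ℝ) ^ ε :=
    one_le_mul_of_one_le_of_one_le hx (Real.one_le_rpow hN hε.le)
  have hexp : (N : ℝ) ^ ((j : ℝ) ^ 2 * ε') * (N : ℝ) ^ (6 * ε') ≤ (N : ℝ) ^ ε := by
    rw [← Real.rpow_add (by positivity)]
    exact Real.rpow_le_rpow_of_exponent_le hN (by linarith)
  calc weylMajorant j N (k • ω)
      ≤ j * (N : ℝ) ^ j + B ^ j * ∑ m ∈ Icc 1 (N ^ j), linearMajorant N (m • k • ω) := hw
    _ ≤ j * ((N : ℝ) ^ j * (x * (N : ℝ) ^ ε)) +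
        B ^ j * (C * ((N : ℝ) ^ j * x * (N : ℝ) ^ (6 * ε'))) := by
        gcongr
        · exact le_mul_of_one_le_right (by positivity) hNe
        · exact hsum ω hω k hk N hkN j
    _ = j * ((N : ℝ) ^ j * x * (N : ℝ) ^ ε) + T ^ j * C * ((N : ℝ) ^ j * x *
        ((N : ℝ) ^ ((j : ℝ) ^ 2 * ε') * (N : ℝ) ^ (6 * ε'))) := by rw [hBj]; ring
    _ ≤ j * ((N : ℝ) ^ j * x * (N : ℝ) ^ ε) + T ^ j * C * ((N : ℝ) ^ j * x * (N : ℝ) ^ ε) := by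
        gcongr
    _ = _ := by ring

/-- A normalized exponential sum of degree `j + 1 ≤ d` with leading difference `k • ω` is at most
`C (|k| / N) ^ (2 ^ (1 - d)) N ^ ε`. -/
theorem exists_norm_sum_polyPhase_le_of_degree (d j : ℕ) (hj : j + 1 ≤ d) {γ ε : ℝ}
    (hγ : 0 < γ) (hε : 0 < ε) :
    ∃ C : ℝ, 1 ≤ C ∧ ∀ ω ∈ DC γ, ∀ k : ℤ, k ≠ 0 → ∀ N : ℕ, |(k : ℝ)| ≤ N →
      ∀ f : ℕ → UnitAddCircle, IsPolyPhase (j + 1) (k • ω) f →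
        ‖∑ n ∈ range N, (AddCircle.toCircle (f n) : ℂ)‖ / N
          ≤ C * ((|(k : ℝ)| / N) ^ ((2 : ℝ) ^ (d - 1))⁻¹ * (N : ℝ) ^ ε) := by
  obtain ⟨C, hC, hW⟩ := exists_weylMajorant_zsmul_le j hγ hε
  have hA1 : 1 ≤ 2 ^ 2 ^ j * C := one_le_mul_of_one_le_of_one_le (one_le_pow₀ one_le_two) hC
  refine ⟨2 ^ 2 ^ j * C, hA1, fun ω hω k hk N hkN f hf => ?_⟩
  have hx : (1 : ℝ) ≤ |(k : ℝ)| := by exact_mod_cast Int.one_le_abs hk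
  set x := |(k : ℝ)| with hxdef
  have hN : (1 : ℝ) ≤ N := hx.trans hkN
  have hN0 : (0 : ℝ) < N := by linarith
  set S := ‖∑ n ∈ range N, (AddCircle.toCircle (f n) : ℂ)‖ with hS
  have hS0 : 0 ≤ S := norm_nonneg _
  set y := S / N with hy
  have hy0 : 0 ≤ y := by positivity
  have hy1 : y ≤ 1 := by
    rw [hy, div_le_one hN0]
    simpa using norm_sum_toCircle_le (range N) f
  have h1 := norm_sum_polyPhase_pow_le j hf (le_refl N)
  have h2 : y ^ 2 ^ j ≤ 2 ^ 2 ^ j * C * (x / N * (N : ℝ) ^ ε) := by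
    have h3 : S ^ 2 ^ j * (N : ℝ) ^ (j + 1)
        ≤ 2 ^ 2 ^ j * (N : ℝ) ^ 2 ^ j * (C * ((N : ℝ) ^ j * x * (N : ℝ) ^ ε)) := by
      refine h1.trans ?_
      gcongr
      exact hW ω hω k hk N hkN
    rw [hy, div_pow, div_le_iff₀ (by positivity)]
    have h4 : 0 < (N : ℝ) ^ (j + 1) := by positivity
    refine le_of_mul_le_mul_right (h3.trans (le_of_eq ?_)) h4
    rw [pow_succ]
    field_simp
  have hδ0 : 0 < ((2 : ℝ) ^ (d - 1))⁻¹ := by positivity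
  have hδ1 : ((2 : ℝ) ^ (d - 1))⁻¹ ≤ 1 := inv_le_one_of_one_le₀ (one_le_pow₀ one_le_two)
  -- Since `y ≤ 1`, the stronger bounds for lower degrees weaken to the exponent of degree `d`.
  have h5 : y ^ 2 ^ (d - 1) ≤ 2 ^ 2 ^ j * C * (x / N * (N : ℝ) ^ ε) :=
    (pow_le_pow_of_le_one hy0 hy1 (Nat.pow_le_pow_right two_pos (by omega))).trans h2
  set A := 2 ^ 2 ^ j * C with hA
  calc y = (y ^ 2 ^ (d - 1)) ^ ((2 : ℝ) ^ (d - 1))⁻¹ := by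
        rw [← Real.rpow_natCast, ← Real.rpow_mul hy0]
        push_cast
        rw [mul_inv_cancel₀ (by positivity), Real.rpow_one]
    _ ≤ (A * (x / N * (N : ℝ) ^ ε)) ^ ((2 : ℝ) ^ (d - 1))⁻¹ := by gcongr
    _ = A ^ ((2 : ℝ) ^ (d - 1))⁻¹ * ((x / N) ^ ((2 : ℝ) ^ (d - 1))⁻¹ *
        ((N : ℝ) ^ ε) ^ ((2 : ℝ) ^ (d - 1))⁻¹) := by
        rw [Real.mul_rpow (x := A) (by positivity) (by positivity),
          Real.mul_rpow (x := x / N) (by positivity) (by positivity)]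
    _ ≤ A * ((x / N) ^ ((2 : ℝ) ^ (d - 1))⁻¹ * (N : ℝ) ^ ε) := by
        gcongr
        · exact Real.rpow_le_self_of_one_le hA1 hδ1
        · exact Real.rpow_le_self_of_one_le (Real.one_le_rpow hN hε.le) hδ1

/-- One constant for all degrees, and no restriction on `k`: when `|k| > N` the right side is at
least `1` and the bound is trivial. -/
theorem exists_norm_sum_polyPhase_le (d : ℕ) {γ ε : ℝ} (hγ : 0 < γ) (hε : 0 < ε) :
    ∃ C : ℝ, 1 ≤ C ∧ ∀ j : ℕ, j + 1 ≤ d → ∀ ω ∈ DC γ, ∀ k : ℤ, k ≠ 0 → ∀ N : ℕ, 1 ≤ N →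
      ∀ f : ℕ → UnitAddCircle, IsPolyPhase (j + 1) (k • ω) f →
        ‖∑ n ∈ range N, (AddCircle.toCircle (f n) : ℂ)‖ / N
          ≤ C * ((|(k : ℝ)| / N) ^ ((2 : ℝ) ^ (d - 1))⁻¹ * (N : ℝ) ^ ε) := by
  choose C hC1 hC using fun j : Fin d =>
    exists_norm_sum_polyPhase_le_of_degree d j j.2 hγ hε
  have hC0 : 0 ≤ ∑ j, C j := sum_nonneg fun j _ => zero_le_one.trans (hC1 j)
  refine ⟨1 + ∑ j, C j, by linarith, fun j hj ω hω k hk N hN f hf => ?_⟩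
  have hN' : (1 : ℝ) ≤ N := by exact_mod_cast hN
  rcases le_or_gt |(k : ℝ)| N with hkN | hkN
  · refine (hC ⟨j, hj⟩ ω hω k hk N hkN f hf).trans ?_
    gcongr
    have := single_le_sum (f := C) (fun j _ => zero_le_one.trans (hC1 j)) (mem_univ ⟨j, hj⟩)
    linarith
  · have h1 : ‖∑ n ∈ range N, (AddCircle.toCircle (f n) : ℂ)‖ / N ≤ 1 := by
      rw [div_le_one (by positivity)]
      simpa using norm_sum_toCircle_le (range N) f
    refine h1.trans (one_le_mul_of_one_le_of_one_le (by linarith)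
      (one_le_mul_of_one_le_of_one_le (Real.one_le_rpow ?_ (by positivity))
        (Real.one_le_rpow hN' hε.le)))
    rw [le_div_iff₀ (by positivity)]
    linarith

end SkewProduct

/-! ### Characters along orbits are polynomial phases. -/

namespace SkewProduct

open Finset UnitAddTorus

namespace IsPolyPhase

variable {G : Type*} [AddCommGroup G] {D : ℕ} {c c' : G} {f g : ℕ → G}

theorem zero_fun (D : ℕ) : IsPolyPhase D (0 : G) fun _ => 0 := by
  induction D with
  | zero => exact fun _ => rfl
  | succ D ih => intro h; simpa using ih

theorem add (hf : IsPolyPhase D c f) (hg : IsPolyPhase D c' g) :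
    IsPolyPhase D (c + c') fun n => f n + g n := by
  induction D generalizing c c' f g with
  | zero => intro n; beta_reduce; rw [hf n, hg n]
  | succ D ih =>
    intro h
    have := ih (hf h) (hg h)
    rw [← smul_add] at this
    convert this using 2
    exact add_sub_add_comm _ _ _ _

theorem zsmul (hf : IsPolyPhase D c f) (k : ℤ) : IsPolyPhase D (k • c) fun n => k • f n := by
  induction D generalizing c f with
  | zero => intro n; beta_reduce; rw [hf n]
  | succ D ih =>
    intro h
    have := ih (hf h)
    rw [smul_comm] at this
    simpa only [smul_sub] using this

theorem shift (hf : IsPolyPhase D c f) (m : ℕ) : IsPolyPhase D c fun n => f (n + m) := by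
  induction D generalizing c f with
  | zero => intro n; exact hf _
  | succ D ih =>
    intro h
    have := ih (hf h)
    convert this using 3
    ring_nf

theorem succ_zero (hf : IsPolyPhase D c f) : IsPolyPhase (D + 1) 0 f := by
  induction D generalizing c f with
  | zero => intro h n; beta_reduce; rw [hf, hf]; simp
  | succ D ih => intro h; rw [smul_zero]; exact ih (hf h)

theorem of_lt {D' : ℕ} (hf : IsPolyPhase D c f) (h : D < D') : IsPolyPhase D' 0 f := by
  induction D', h using Nat.le_induction with
  | base => exact hf.succ_zero
  | succ n _ ih => exact ih.succ_zero

theorem sum {ι : Type*} (s : Finset ι) {c : ι → G} {f : ι → ℕ → G}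
    (hf : ∀ i ∈ s, IsPolyPhase D (c i) (f i)) :
    IsPolyPhase D (∑ i ∈ s, c i) fun n => ∑ i ∈ s, f i n := by
  classical
  induction s using Finset.induction_on with
  | empty => simpa using zero_fun D
  | insert a s ha ih =>
    simp only [sum_insert ha]
    exact (hf a (mem_insert_self _ _)).add (ih fun i hi => hf i (mem_insert_of_mem hi))

/-- A sequence whose successive differences form a polynomial phase is one itself. -/
theorem of_succ_sub (hg : IsPolyPhase D c g) (hfg : ∀ n, f (n + 1) - f n = g n) :
    IsPolyPhase (D + 1) c f := by
  intro h
  have h1 : (fun n => f (n + h) - f n) = fun n => ∑ m ∈ range h, g (n + m) := by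
    funext n
    simp only [← hfg]
    exact (sum_range_sub (fun m => f (n + m)) h).symm
  rw [h1]
  have := sum (range h) (c := fun _ => c) (f := fun m n => g (n + m)) fun m _ => hg.shift m
  simpa using this

end IsPolyPhase

/-- Along the orbit, the increment of one coordinate is the next coordinate, and the increment of
the last is `ω`. The degree thus grows by one at each step back, while the top difference stays `ω`.
-/
theorem isPolyPhase_iterate_skewMap {d : ℕ} (ω : UnitAddCircle) (x : Torus d) (m : ℕ) (i : Fin d)
    (hi : (i : ℕ) + m + 1 = d) : IsPolyPhase (m + 1) ω fun n => (skewMap d ω)^[n] x i := by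
  induction m generalizing i with
  | zero =>
    refine IsPolyPhase.of_succ_sub (g := fun _ => ω) (fun _ => rfl) fun n => ?_
    rw [Function.iterate_succ_apply', skewMap, dif_neg (by omega)]
    abel
  | succ m ih =>
    refine IsPolyPhase.of_succ_sub (ih ⟨i + 1, by omega⟩ (by simp only; omega)) fun n => ?_
    rw [Function.iterate_succ_apply', skewMap, dif_pos (by omega)]
    abel

/-- Earlier coordinates have higher degree, so the first one with `k i ≠ 0` dominates. The later
ones have lower degree and add nothing to the top difference. -/
theorem exists_isPolyPhase_character {d : ℕ} (ω : UnitAddCircle) (x : Torus d) {k : Fin d → ℤ}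
    (hk : k ≠ 0) : ∃ i : Fin d, k i ≠ 0 ∧ ∃ j : ℕ, j + 1 ≤ d ∧
      IsPolyPhase (j + 1) (k i • ω) fun n => ∑ l, k l • (skewMap d ω)^[n] x l := by
  classical
  have hne : (univ.filter fun i => k i ≠ 0).Nonempty := by
    obtain ⟨i, hi⟩ := Function.ne_iff.1 hk
    exact ⟨i, by simpa using hi⟩
  set i := (univ.filter fun i => k i ≠ 0).min' hne with hi
  have hki : k i ≠ 0 := (mem_filter.1 (min'_mem _ hne)).2
  have hmin : ∀ l, k l ≠ 0 → i ≤ l := fun l hl => min'_le _ _ (by simpa using hl)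
  refine ⟨i, hki, d - 1 - i, by omega, ?_⟩
  have h : ∀ l ∈ (univ : Finset (Fin d)), IsPolyPhase (d - 1 - i + 1)
      (if l = i then k i • ω else 0) fun n => k l • (skewMap d ω)^[n] x l := by
    intro l _
    have hl := isPolyPhase_iterate_skewMap ω x (d - 1 - l) l (by omega)
    split_ifs with hli
    · subst hli; exact hl.zsmul _
    · by_cases hkl : k l = 0
      · simpa [hkl] using IsPolyPhase.zero_fun (G := UnitAddCircle) (d - 1 - i + 1)
      · have h1 := hmin l hkl
        have h2 : (i : ℕ) ≠ l := fun h => hli (Fin.ext h.symm)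
        have h3 : (i : ℕ) ≤ l := h1
        exact (hl.zsmul (k l)).of_lt (by omega)
  simpa using IsPolyPhase.sum univ h

theorem mFourier_eq_toCircle_sum {d : ℕ} (k : Fin d → ℤ) (x : Torus d) :
    mFourier k x = (AddCircle.toCircle (∑ i, k i • x i) : ℂ) := by
  have h : ∀ s : Finset (Fin d), ∏ i ∈ s, fourier (k i) (x i)
      = (AddCircle.toCircle (∑ i ∈ s, k i • x i) : ℂ) := by
    intro s
    induction s using Finset.induction_on with
    | empty => simp
    | insert a s ha ih =>
      rw [prod_insert ha, sum_insert ha, ih, AddCircle.toCircle_add, fourier_apply]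
      rfl
  exact h univ

theorem norm_mFourier_apply {d : ℕ} (k : Fin d → ℤ) (x : Torus d) : ‖mFourier k x‖ = 1 := by
  rw [mFourier_eq_toCircle_sum, Circle.norm_coe]

theorem mFourier_apply_add {d : ℕ} (k : Fin d → ℤ) (x y : Torus d) :
    mFourier k (x + y) = mFourier k x * mFourier k y := by
  simp only [mFourier_eq_toCircle_sum, Pi.add_apply, smul_add, sum_add_distrib,
    AddCircle.toCircle_add, Circle.coe_mul]

theorem mFourier_neg_apply {d : ℕ} (k : Fin d → ℤ) (x : Torus d) :
    mFourier (-k) x = mFourier k (-x) := by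
  simp only [mFourier_eq_toCircle_sum, Pi.neg_apply, neg_smul, smul_neg]

/-- Weyl's bound for the characters along the orbits of the skew product. -/
theorem exists_norm_sum_mFourier_iterate_le (d : ℕ) {γ ε : ℝ} (hγ : 0 < γ) (hε : 0 < ε) :
    ∃ C : ℝ, 1 ≤ C ∧ ∀ ω ∈ DC γ, ∀ k : Fin d → ℤ, k ≠ 0 → ∀ N : ℕ, 1 ≤ N → ∀ x : Torus d,
      ∃ i, ‖∑ n ∈ range N, mFourier k ((skewMap d ω)^[n] x)‖ / N
          ≤ C * ((|(k i : ℝ)| / N) ^ ((2 : ℝ) ^ (d - 1))⁻¹ * (N : ℝ) ^ ε) := by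
  obtain ⟨C, hC, h⟩ := exists_norm_sum_polyPhase_le d hγ hε
  refine ⟨C, hC, fun ω hω k hk N hN x => ?_⟩
  obtain ⟨i, hki, j, hj, hf⟩ := exists_isPolyPhase_character ω x hk
  refine ⟨i, ?_⟩
  simp only [mFourier_eq_toCircle_sum]
  exact h j hj ω hω (k i) hki N hN _ hf

end SkewProduct

/-! ### Jackson kernels on the circle. -/

namespace SkewProduct

open Finset UnitAddTorus MeasureTheory ComplexConjugate

instance : IsProbabilityMeasure (volume : Measure UnitAddCircle) := ⟨UnitAddCircle.measure_univ⟩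

theorem integrable_of_continuous {X E : Type*} [TopologicalSpace X] [CompactSpace X]
    [MeasurableSpace X] [OpensMeasurableSpace X] [NormedAddCommGroup E] {μ : Measure X}
    [IsFiniteMeasureOnCompacts μ] {f : X → E} (hf : Continuous f) : Integrable f μ :=
  hf.integrable_of_hasCompactSupport (HasCompactSupport.of_compactSpace f)

/-- For `n ≠ 0`, translation by half a period of `fourier n` changes the sign of the integrand but
not the integral. -/
theorem integral_fourier_eq_ite (n : ℤ) :
    ∫ y : UnitAddCircle, fourier n y = if n = 0 then 1 else 0 := by
  split_ifs with h
  · simp [h]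
  · have h1 := integral_add_right_eq_self (μ := (volume : Measure UnitAddCircle))
      (fun y => fourier n y) (((1 : ℝ) / 2 / n : ℝ) : UnitAddCircle)
    simp only [fourier_add_half_inv_index h one_pos] at h1
    rw [integral_neg] at h1
    exact self_eq_neg.1 h1.symm

/-- The trigonometric polynomial with real coefficients `a 0, …, a (L - 1)`. -/
noncomputable def trigPoly (a : ℕ → ℝ) (L : ℕ) (y : UnitAddCircle) : ℂ :=
  ∑ n ∈ range L, (a n : ℂ) * fourier (n : ℤ) y

theorem continuous_trigPoly (a : ℕ → ℝ) (L : ℕ) : Continuous (trigPoly a L) := by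
  unfold trigPoly; fun_prop

theorem norm_sq_trigPoly (a : ℕ → ℝ) (L : ℕ) (y : UnitAddCircle) :
    ((‖trigPoly a L y‖ ^ 2 : ℝ) : ℂ)
      = ∑ n ∈ range L, ∑ m ∈ range L, ((a n * a m : ℝ) : ℂ) * fourier ((n : ℤ) - m) y := by
  rw [← Complex.normSq_eq_norm_sq, ← Complex.mul_conj, trigPoly, map_sum, sum_mul_sum]
  refine sum_congr rfl fun n _ => sum_congr rfl fun m _ => ?_
  rw [map_mul, Complex.conj_ofReal, ← fourier_neg, sub_eq_add_neg, fourier_add]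
  push_cast
  ring

theorem integral_norm_sq_trigPoly (a : ℕ → ℝ) (L : ℕ) :
    ∫ y, ‖trigPoly a L y‖ ^ 2 = ∑ n ∈ range L, a n ^ 2 := by
  have hint : ∀ (n m : ℕ), Integrable
      (fun y : UnitAddCircle => ((a n * a m : ℝ) : ℂ) * fourier ((n : ℤ) - m) y) volume :=
    fun n m => integrable_of_continuous (by fun_prop)
  have h : ∫ y, ((‖trigPoly a L y‖ ^ 2 : ℝ) : ℂ) = ((∑ n ∈ range L, a n ^ 2 : ℝ) : ℂ) := by
    simp only [norm_sq_trigPoly]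
    rw [integral_finsetSum _ fun n _ => integrable_finsetSum _ fun m _ => hint n m]
    push_cast
    refine sum_congr rfl fun n hn => ?_
    rw [integral_finsetSum _ fun m _ => by simpa using hint n m]
    simp only [integral_const_mul, integral_fourier_eq_ite, sub_eq_zero, Nat.cast_inj, mul_ite,
      mul_one, mul_zero, sum_ite_eq, hn, if_true]
    ring
  rw [integral_complex_ofReal] at h
  exact_mod_cast h

/-- Summation by parts without boundary terms, because `a` vanishes at both ends. At `n = 0`
truncated subtraction makes the new coefficient `a 0 - a 0 = 0`. -/
theorem fourier_one_sub_one_mul_trigPoly {a : ℕ → ℝ} {L : ℕ} (h0 : a 0 = 0) (hL : a L = 0)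
    (y : UnitAddCircle) :
    (fourier 1 y - 1) * trigPoly a L y = trigPoly (fun n => a (n - 1) - a n) (L + 1) y := by
  have h1 : fourier 1 y * trigPoly a L y
      = ∑ n ∈ range (L + 1), (a (n - 1) : ℂ) * fourier (n : ℤ) y := by
    rw [sum_range_succ', trigPoly, mul_sum]
    simp only [Nat.add_sub_cancel, h0, Nat.zero_sub, Complex.ofReal_zero, zero_mul, add_zero]
    refine sum_congr rfl fun n _ => ?_
    push_cast
    rw [fourier_add]; ring
  have h2 : trigPoly a L y = ∑ n ∈ range (L + 1), (a n : ℂ) * fourier (n : ℤ) y := by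
    rw [sum_range_succ, hL, trigPoly]; simp
  rw [sub_mul, h1, one_mul, h2, ← sum_sub_distrib, trigPoly]
  refine sum_congr rfl fun n _ => ?_
  push_cast; ring

/-- As `4‖y‖ ≤ ‖e(y) - 1‖`, the second moment is controlled by the `L²` norm of `(e(y) - 1)` times
the polynomial, which Parseval evaluates. -/
theorem integral_norm_sq_trigPoly_mul_norm_sq_le {a : ℕ → ℝ} {L : ℕ} (h0 : a 0 = 0)
    (hL : a L = 0) :
    ∫ y, ‖trigPoly a L y‖ ^ 2 * ‖y‖ ^ 2
      ≤ (∑ n ∈ range (L + 1), (a (n - 1) - a n) ^ 2) / 16 := by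
  rw [← integral_norm_sq_trigPoly, ← integral_div]
  have hc := continuous_trigPoly a L
  have hc' := continuous_trigPoly (fun n => a (n - 1) - a n) (L + 1)
  refine integral_mono (integrable_of_continuous (by fun_prop))
    (integrable_of_continuous (by fun_prop)) fun y => ?_
  beta_reduce
  rw [← fourier_one_sub_one_mul_trigPoly h0 hL, norm_mul, mul_pow, fourier_one]
  have h := four_mul_norm_le_norm_toCircle_sub_one y
  have h2 : (4 * ‖y‖) ^ 2 ≤ ‖(AddCircle.toCircle y : ℂ) - 1‖ ^ 2 := by gcongr
  nlinarith [sq_nonneg ‖trigPoly a L y‖]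

/-- An autocorrelation is largest at lag zero, by `|ab| ≤ (a² + b²)/2`. This gives `|w k| ≤ 1` for
the kernel. -/
theorem sum_sum_ite_sub_eq_mul_le {a : ℕ → ℝ} (L : ℕ) (k : ℤ) :
    |∑ n ∈ range L, ∑ m ∈ range L, if (m : ℤ) - n = k then a n * a m else 0|
      ≤ ∑ n ∈ range L, a n ^ 2 := by
  have h1 : ∀ n ∈ range L, ∑ m ∈ range L, (if (m : ℤ) - n = k then a n ^ 2 else 0) ≤ a n ^ 2 := by
    intro n _
    rw [← sum_filter, sum_const, nsmul_eq_mul]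
    refine mul_le_of_le_one_left (sq_nonneg _) ?_
    refine Nat.cast_le_one.2 (card_le_one.2 fun p hp q hq => ?_)
    have hp : (p : ℤ) - n = k := (mem_filter.1 hp).2
    have hq : (q : ℤ) - n = k := (mem_filter.1 hq).2
    omega
  have h2 : ∀ m ∈ range L, ∑ n ∈ range L, (if (m : ℤ) - n = k then a m ^ 2 else 0) ≤ a m ^ 2 := by
    intro m _
    rw [← sum_filter, sum_const, nsmul_eq_mul]
    refine mul_le_of_le_one_left (sq_nonneg _) ?_
    refine Nat.cast_le_one.2 (card_le_one.2 fun p hp q hq => ?_)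
    have hp : (m : ℤ) - p = k := (mem_filter.1 hp).2
    have hq : (m : ℤ) - q = k := (mem_filter.1 hq).2
    omega
  calc |∑ n ∈ range L, ∑ m ∈ range L, if (m : ℤ) - n = k then a n * a m else 0|
      ≤ ∑ n ∈ range L, ∑ m ∈ range L, |if (m : ℤ) - n = k then a n * a m else 0| :=
        (abs_sum_le_sum_abs _ _).trans (sum_le_sum fun n _ => abs_sum_le_sum_abs _ _)
    _ ≤ ∑ n ∈ range L, ∑ m ∈ range L, ((if (m : ℤ) - n = k then a n ^ 2 else 0) / 2 +
          (if (m : ℤ) - n = k then a m ^ 2 else 0) / 2) := by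
        refine sum_le_sum fun n _ => sum_le_sum fun m _ => ?_
        split_ifs
        · rw [abs_le]; constructor <;> nlinarith [sq_nonneg (a n + a m), sq_nonneg (a n - a m)]
        · simp
    _ = (∑ n ∈ range L, ∑ m ∈ range L, if (m : ℤ) - n = k then a n ^ 2 else 0) / 2 +
          (∑ m ∈ range L, ∑ n ∈ range L, if (m : ℤ) - n = k then a m ^ 2 else 0) / 2 := by
        simp only [sum_add_distrib, sum_div]
        congr 1
        exact sum_comm
    _ ≤ (∑ n ∈ range L, a n ^ 2) / 2 + (∑ n ∈ range L, a n ^ 2) / 2 := by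
        gcongr with n hn n hn
        · exact h1 n hn
        · exact h2 n hn
    _ = _ := by ring

theorem cube_le_three_mul_sum_sq (M : ℕ) :
    (M : ℝ) ^ 3 ≤ 3 * ∑ n ∈ range (M + 1), (n : ℝ) ^ 2 := by
  induction M with
  | zero => simp
  | succ M ih =>
    rw [sum_range_succ]
    push_cast
    nlinarith [Nat.cast_nonneg (α := ℝ) M]

/-- A Jackson kernel: a nonnegative trigonometric polynomial of degree at most `2 M`, of integral
one, and with second moment at most `1 / M ^ 2`. -/
theorem exists_jackson_kernel (M : ℕ) (hM : 1 ≤ M) :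
    ∃ (J : UnitAddCircle → ℝ) (w : ℤ → ℝ), Continuous J ∧ (∀ y, 0 ≤ J y) ∧
      (∀ y, (J y : ℂ) = ∑ k ∈ Icc (-(2 * M : ℤ)) (2 * M), (w k : ℂ) * fourier (-k) y) ∧
      w 0 = 1 ∧ (∀ k, |w k| ≤ 1) ∧ ∫ y, J y = 1 ∧ ∫ y, J y * ‖y‖ ^ 2 ≤ 1 / (M : ℝ) ^ 2 := by
  -- A tent on `[0, 2M]`: its steps are at most `1`, so the energy of its differences is `O(M)`,
  -- whereas its own energy `A` is at least `M³/3`. The quotient is the second moment `O(M⁻²)`.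
  set a : ℕ → ℝ := fun n => min (n : ℝ) (2 * M - n) with ha
  set L := 2 * M with hL
  have hM' : (1 : ℝ) ≤ M := by exact_mod_cast hM
  have ha0 : a 0 = 0 := by simp [ha]
  have haL : a L = 0 := by simp [ha, hL]
  set A := ∑ n ∈ range L, a n ^ 2 with hA
  have hA3 : (M : ℝ) ^ 3 ≤ 3 * A := by
    refine (cube_le_three_mul_sum_sq M).trans ?_
    gcongr
    calc ∑ n ∈ range (M + 1), (n : ℝ) ^ 2 = ∑ n ∈ range (M + 1), a n ^ 2 := by
          refine sum_congr rfl fun n hn => ?_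
          have hn : (n : ℝ) ≤ M := by exact_mod_cast Nat.lt_succ_iff.1 (mem_range.1 hn)
          simp only [ha]
          rw [min_eq_left (by linarith)]
      _ ≤ ∑ n ∈ range (L + 1), a n ^ 2 :=
          sum_le_sum_of_subset_of_nonneg (range_mono (by omega)) fun _ _ _ => sq_nonneg _
      _ = A := by rw [sum_range_succ, haL]; simp [hA]
  have hA0 : 0 < A := by
    have : 0 < (M : ℝ) ^ 3 := by positivity
    linarith
  have hdiff : ∀ n, (a (n - 1) - a n) ^ 2 ≤ 1 := by
    intro n
    rw [sq_le_one_iff_abs_le_one]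
    rcases n with _ | n
    · simp
    · simp only [ha, Nat.add_sub_cancel]
      refine (abs_min_sub_min_le_max _ _ _ _).trans ?_
      push_cast
      refine max_le ?_ ?_ <;> rw [abs_le] <;> constructor <;> linarith
  refine ⟨fun y => ‖trigPoly a L y‖ ^ 2 / A,
    fun k => (∑ n ∈ range L, ∑ m ∈ range L, if (m : ℤ) - n = k then a n * a m else 0) / A,
    ?_, fun y => by positivity, fun y => ?_, ?_, fun k => ?_, ?_, ?_⟩
  · have := continuous_trigPoly a L
    fun_prop
  · have hmem : ∀ n ∈ range L, ∀ m ∈ range L,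
        (m : ℤ) - n ∈ Icc (-(2 * M : ℤ)) (2 * M) := fun n hn m hm => by
      rw [mem_range] at hn hm
      rw [mem_Icc]; constructor <;> omega
    rw [Complex.ofReal_div, norm_sq_trigPoly]
    simp only [Complex.ofReal_div, Complex.ofReal_sum, div_mul_eq_mul_div]
    rw [← sum_div]
    congr 1
    simp only [sum_mul]
    symm
    rw [sum_comm]
    refine sum_congr rfl fun n hn => ?_
    rw [sum_comm]
    refine sum_congr rfl fun m hm => ?_
    rw [sum_eq_single ((m : ℤ) - n)]
    · rw [if_pos rfl, neg_sub]
    · intro k _ hk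
      rw [if_neg hk.symm]; simp
    · intro h; exact absurd (hmem n hn m hm) h
  · rw [div_eq_one_iff_eq hA0.ne', hA]
    refine sum_congr rfl fun n hn => ?_
    simp only [sub_eq_zero, Nat.cast_inj, sum_ite_eq', hn, if_true]
    ring
  · rw [abs_div, abs_of_pos hA0, div_le_one hA0]
    exact sum_sum_ite_sub_eq_mul_le L k
  · rw [integral_div, integral_norm_sq_trigPoly, div_self hA0.ne']
  · simp only [div_mul_eq_mul_div]
    rw [integral_div, div_le_div_iff₀ hA0 (by positivity), one_mul]
    have h1 := integral_norm_sq_trigPoly_mul_norm_sq_le ha0 haL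
    have h2 : ∑ n ∈ range (L + 1), (a (n - 1) - a n) ^ 2 ≤ 3 * M := by
      calc ∑ n ∈ range (L + 1), (a (n - 1) - a n) ^ 2
          ≤ ∑ _n ∈ range (L + 1), (1 : ℝ) := sum_le_sum fun n _ => hdiff n
        _ = 2 * M + 1 := by simp [hL]
        _ ≤ _ := by linarith
    have h3 : ∫ y, ‖trigPoly a L y‖ ^ 2 * ‖y‖ ^ 2 ≤ 3 * M / 16 := by linarith
    calc _ ≤ 3 * M / 16 * (M : ℝ) ^ 2 := by gcongr
      _ ≤ A := by nlinarith [pow_pos (zero_lt_one.trans_le hM') 3]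

end SkewProduct

/-! ### Trigonometric approximation on the torus. -/

namespace SkewProduct

open Finset UnitAddTorus MeasureTheory ComplexConjugate

variable {d : ℕ}

/-- The decay of the Fourier coefficients of a Hölder function. -/
theorem norm_integral_mul_mFourier_le {α H : NNReal} {φ : C(Torus d, ℝ)} (hφ : HolderWith H α φ)
    {k : Fin d → ℤ} {i : Fin d} (hi : k i ≠ 0) :
    ‖∫ y, (φ y : ℂ) * mFourier (-k) y‖ ≤ H * |(k i : ℝ)| ^ (-(α : ℝ)) := by
  classical
  set t : UnitAddCircle := (((1 : ℝ) / 2 / ((-k) i : ℤ) : ℝ) : UnitAddCircle) with ht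
  set v : Torus d := Pi.single i t with hv
  have hk1 : (1 : ℝ) ≤ |(k i : ℝ)| := by exact_mod_cast Int.one_le_abs hi
  have hvnorm : ‖v‖ ≤ |(k i : ℝ)|⁻¹ := by
    rw [hv, Pi.norm_single]
    refine (QuotientAddGroup.norm_mk_le_norm).trans ?_
    rw [Real.norm_eq_abs, Pi.neg_apply, Int.cast_neg, abs_div, abs_neg, ← one_div]
    gcongr
    norm_num [abs_of_pos]
  -- Moving coordinate `i` by half a period changes the sign of the character, so the coefficient is
  -- half the integral of `φ y - φ (y + v)` against it.
  have hchar : ∀ y, mFourier (-k) (y + v) = -mFourier (-k) y := by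
    intro y
    rw [mFourier_apply_add]
    have h1 : mFourier (-k) v = -1 := by
      have h2 := fourier_add_half_inv_index (T := 1) (n := (-k) i) (by simpa using hi) one_pos 0
      rw [zero_add, fourier_eval_zero, fourier_apply] at h2
      rw [mFourier_eq_toCircle_sum, sum_eq_single i, hv, Pi.single_eq_same]
      · exact h2
      · intro j _ hj
        rw [hv, Pi.single_eq_of_ne hj, smul_zero]
      · simp
    rw [h1]; ring
  have hint : ∀ z : Torus d,
      Integrable (fun y => (φ (y + z) : ℂ) * mFourier (-k) y) (volume : Measure (Torus d)) :=
    fun z => integrable_of_continuous (by fun_prop)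
  have hshift : ∫ y, (φ y : ℂ) * mFourier (-k) y = -∫ y, (φ (y + v) : ℂ) * mFourier (-k) y := by
    rw [← integral_add_right_eq_self (fun y => (φ y : ℂ) * mFourier (-k) y) v, ← integral_neg]
    simp only [hchar, mul_neg]
  have htwo : 2 * ∫ y, (φ y : ℂ) * mFourier (-k) y
      = ∫ y, ((φ y : ℂ) * mFourier (-k) y - (φ (y + v) : ℂ) * mFourier (-k) y) := by
    rw [integral_sub (by simpa using hint 0) (hint v), two_mul, sub_eq_add_neg, ← hshift]
  have hbound : ‖∫ y, ((φ y : ℂ) * mFourier (-k) y - (φ (y + v) : ℂ) * mFourier (-k) y)‖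
      ≤ H * |(k i : ℝ)| ^ (-(α : ℝ)) := by
    refine (norm_integral_le_of_norm_le_const (C := H * |(k i : ℝ)| ^ (-(α : ℝ)))
      (Filter.Eventually.of_forall fun y => ?_)).trans (by simp)
    rw [← sub_mul, norm_mul, norm_mFourier_apply, mul_one, ← Complex.ofReal_sub,
      Complex.norm_real, ← dist_eq_norm]
    refine (hφ.dist_le _ _).trans ?_
    rw [dist_self_add_right, Real.rpow_neg (by positivity), ← Real.inv_rpow (by positivity)]
    gcongr
  have h2 : 2 * ‖∫ y, (φ y : ℂ) * mFourier (-k) y‖ ≤ H * |(k i : ℝ)| ^ (-(α : ℝ)) := by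
    rw [← htwo, norm_mul] at hbound
    simpa using hbound
  linarith [norm_nonneg (∫ y, (φ y : ℂ) * mFourier (-k) y)]

/-- This lets the second moment of the kernel control its `α`-th moment, with a constant independent
of `α`. -/
theorem rpow_mul_rpow_le_one_add_sq {M r α : ℝ} (hM : 0 ≤ M) (hr : 0 ≤ r) (hα0 : 0 ≤ α)
    (hα : α ≤ 1) : M ^ α * r ^ α ≤ 1 + M ^ 2 * r ^ 2 := by
  rw [← Real.mul_rpow hM hr, ← mul_pow]
  have h0 : 0 ≤ M * r := mul_nonneg hM hr
  rcases le_total (M * r) 1 with h | h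
  · have := Real.rpow_le_one h0 h hα0
    nlinarith [sq_nonneg (M * r)]
  · have := Real.rpow_le_self_of_one_le h hα
    nlinarith

/-- Jackson's theorem on the torus, for Hölder functions, with control of the coefficients of the
approximating trigonometric polynomial. -/
theorem exists_trigonometric_approximation {α H : NNReal} (hα : α ≤ 1) {φ : C(Torus d, ℝ)}
    (hφ : HolderWith H α φ) {M : ℕ} (hM : 1 ≤ M) :
    ∃ c : (Fin d → ℤ) → ℂ, c 0 = ((∫ y, φ y : ℝ) : ℂ) ∧
      (∀ k i, k i ≠ 0 → ‖c k‖ ≤ H * |(k i : ℝ)| ^ (-(α : ℝ))) ∧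
      ∀ x, ‖(φ x : ℂ) -
          ∑ k ∈ Fintype.piFinset fun _ => Icc (-(2 * M : ℤ)) (2 * M), c k * mFourier k x‖
        ≤ (1 + d) * (H * (M : ℝ) ^ (-(α : ℝ))) := by
  obtain ⟨J, w, hJc, hJ0, hJw, hw0, hw1, hJ1, hJ2⟩ := exists_jackson_kernel M hM
  have hM' : (1 : ℝ) ≤ M := by exact_mod_cast hM
  set box := Fintype.piFinset fun _ : Fin d => Icc (-(2 * M : ℤ)) (2 * M) with hbox
  set K : Torus d → ℝ := fun y => ∏ i, J (y i) with hK
  have hKc : Continuous K := by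
    simp only [hK]
    exact continuous_finsetProd _ fun i _ => hJc.comp (continuous_apply i)
  have hK0 : ∀ y, 0 ≤ K y := fun y => prod_nonneg fun i _ => hJ0 _
  have hK1 : ∫ y, K y = 1 := by
    simp only [hK]
    rw [integral_fintype_prod_volume_eq_prod fun _ => J]
    simp [hJ1]
  have hK2 : ∀ i, ∫ y, K y * ‖y i‖ ^ 2 ≤ 1 / (M : ℝ) ^ 2 := by
    intro i
    have h1 : ∀ y : Torus d, K y * ‖y i‖ ^ 2
        = ∏ j, (if j = i then fun u => J u * ‖u‖ ^ 2 else J) (y j) := by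
      intro y
      rw [← mul_prod_erase univ _ (mem_univ i), if_pos rfl]
      simp only [hK]
      rw [← mul_prod_erase univ _ (mem_univ i)]
      have : ∏ j ∈ univ.erase i, (if j = i then fun u => J u * ‖u‖ ^ 2 else J) (y j)
          = ∏ j ∈ univ.erase i, J (y j) :=
        prod_congr rfl fun j hj => by rw [if_neg (ne_of_mem_erase hj)]
      rw [this]; ring
    simp only [h1]
    rw [integral_fintype_prod_volume_eq_prod
      fun j => (if j = i then fun u => J u * ‖u‖ ^ 2 else J),
      ← mul_prod_erase univ _ (mem_univ i), if_pos rfl, prod_congr rfl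
        (g := fun _ => (1 : ℝ)) fun j hj => by rw [if_neg (ne_of_mem_erase hj), hJ1]]
    simpa using hJ2
  have hKw : ∀ y, (K y : ℂ) = ∑ k ∈ box, (∏ i, (w (k i) : ℂ)) * mFourier (-k) y := by
    intro y
    simp only [hK, Complex.ofReal_prod, hJw]
    rw [prod_univ_sum]
    refine sum_congr rfl fun k _ => ?_
    rw [prod_mul_distrib]
    rfl
  -- The Fourier coefficients of `φ` convolved with the kernel: `w 0 = 1` preserves the mean and `|w
  -- k| ≤ 1` preserves the decay.
  refine ⟨fun k => (∏ i, (w (k i) : ℂ)) * ∫ y, (φ y : ℂ) * mFourier (-k) y, ?_, ?_, ?_⟩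
  · simp only [Pi.zero_apply, hw0, Complex.ofReal_one, prod_const_one, one_mul, neg_zero,
      mFourier_zero, ContinuousMap.one_apply, mul_one]
    exact integral_complex_ofReal
  · intro k i hi
    rw [norm_mul]
    refine (mul_le_of_le_one_left (norm_nonneg _) ?_).trans (norm_integral_mul_mFourier_le hφ hi)
    rw [norm_prod]
    refine prod_le_one (fun _ _ => norm_nonneg _) fun j _ => ?_
    rw [Complex.norm_real]
    exact hw1 _
  · intro x
    have hconv : ((∫ y, φ (x + y) * K y : ℝ) : ℂ)
        = ∑ k ∈ box, (∏ i, (w (k i) : ℂ)) * (∫ y, (φ y : ℂ) * mFourier (-k) y) *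
            mFourier k x := by
      rw [← integral_add_left_eq_self (fun y => φ (x + y) * K y) (-x)]
      simp only [add_neg_cancel_left]
      rw [← integral_complex_ofReal]
      have h1 : ∀ y : Torus d, ((φ y * K (-x + y) : ℝ) : ℂ) = ∑ k ∈ box,
          (∏ i, (w (k i) : ℂ)) * mFourier k x * ((φ y : ℂ) * mFourier (-k) y) := by
        intro y
        rw [Complex.ofReal_mul, hKw, mul_sum]
        refine sum_congr rfl fun k _ => ?_
        rw [mFourier_apply_add, mFourier_neg_apply k (-x), neg_neg]
        ring
      simp only [h1]
      rw [integral_finsetSum _ fun k _ => integrable_of_continuous (by fun_prop)]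
      refine sum_congr rfl fun k _ => ?_
      rw [integral_const_mul]; ring
    rw [← hconv, ← Complex.ofReal_sub, Complex.norm_real, Real.norm_eq_abs]
    have hsub : φ x - ∫ y, φ (x + y) * K y = ∫ y, (φ x - φ (x + y)) * K y := by
      simp only [sub_mul]
      rw [integral_sub (integrable_of_continuous (by fun_prop))
        (integrable_of_continuous (by fun_prop)), integral_const_mul, hK1, mul_one]
    have hpt : ∀ y : Torus d, |(φ x - φ (x + y)) * K y| ≤ H * (M : ℝ) ^ (-(α : ℝ)) *
        (K y + (M : ℝ) ^ 2 * ∑ i, K y * ‖y i‖ ^ 2) := by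
      intro y
      have h1 : |φ x - φ (x + y)| ≤ H * ‖y‖ ^ (α : ℝ) := by
        have := hφ.dist_le x (x + y)
        rwa [dist_self_add_right, Real.dist_eq] at this
      have h2 : ‖y‖ ^ 2 ≤ ∑ i, ‖y i‖ ^ 2 := by
        have h0 : 0 ≤ ∑ i, ‖y i‖ ^ 2 := sum_nonneg fun i _ => sq_nonneg _
        rw [← Real.le_sqrt (norm_nonneg _) h0, pi_norm_le_iff_of_nonneg (Real.sqrt_nonneg _)]
        intro i
        rw [Real.le_sqrt (norm_nonneg _) h0]
        exact single_le_sum (f := fun i => ‖y i‖ ^ 2) (fun _ _ => sq_nonneg _) (mem_univ i)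
      have h3 := rpow_mul_rpow_le_one_add_sq (M := M) (r := ‖y‖) (α := α) (by positivity)
        (norm_nonneg y) α.2 (by exact_mod_cast hα)
      have hMα : (0 : ℝ) < (M : ℝ) ^ (α : ℝ) := by positivity
      have h4 : ‖y‖ ^ (α : ℝ) ≤ (M : ℝ) ^ (-(α : ℝ)) * (1 + (M : ℝ) ^ 2 * ∑ i, ‖y i‖ ^ 2) := by
        rw [Real.rpow_neg (by positivity), ← div_eq_inv_mul, le_div_iff₀ hMα, mul_comm]
        refine h3.trans ?_
        gcongr
      rw [abs_mul, abs_of_nonneg (hK0 y), ← mul_sum]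
      calc _ ≤ H * ((M : ℝ) ^ (-(α : ℝ)) * (1 + (M : ℝ) ^ 2 * ∑ i, ‖y i‖ ^ 2)) * K y := by
            have := hK0 y
            gcongr
            exact h1.trans (by gcongr)
        _ = _ := by ring
    rw [hsub]
    have hI : ∀ i : Fin d, Integrable (fun y : Torus d => K y * ‖y i‖ ^ 2) volume :=
      fun i => integrable_of_continuous (by fun_prop)
    have hKI : Integrable K volume := integrable_of_continuous hKc
    calc |∫ y, (φ x - φ (x + y)) * K y| ≤ ∫ y, |(φ x - φ (x + y)) * K y| :=
          abs_integral_le_integral_abs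
      _ ≤ ∫ y, H * (M : ℝ) ^ (-(α : ℝ)) * (K y + (M : ℝ) ^ 2 * ∑ i, K y * ‖y i‖ ^ 2) :=
          integral_mono (integrable_of_continuous (by fun_prop))
            (integrable_of_continuous (by fun_prop)) hpt
      _ = H * (M : ℝ) ^ (-(α : ℝ)) * (1 + (M : ℝ) ^ 2 * ∑ i, ∫ y, K y * ‖y i‖ ^ 2) := by
          rw [integral_const_mul, integral_add hKI
            ((integrable_finsetSum _ fun i _ => hI i).const_mul _), hK1, integral_const_mul,
            integral_finsetSum _ fun i _ => hI i]
      _ ≤ H * (M : ℝ) ^ (-(α : ℝ)) * (1 + (M : ℝ) ^ 2 * ∑ _i : Fin d, 1 / (M : ℝ) ^ 2) := by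
          gcongr with i
          exact hK2 i
      _ = _ := by
          rw [sum_const, card_univ, Fintype.card_fin, nsmul_eq_mul]
          field_simp

end SkewProduct

/-! ### Summing over frequencies and choosing the degree. -/

namespace SkewProduct

open Finset UnitAddTorus MeasureTheory

theorem sum_Icc_neg_one_div_max_le (L : ℕ) :
    ∑ n ∈ Icc (-(L : ℤ)) L, 1 / max 1 |(n : ℝ)| ≤ 4 + 2 * Real.log L := by
  have heven : Function.Even fun n : ℤ => 1 / max 1 |(n : ℝ)| := fun n => by simp
  rw [sum_Icc_of_even_eq_range heven, sum_range_succ']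
  have h1 : ∑ n ∈ range L, 1 / max 1 |(((n + 1 : ℕ) : ℤ) : ℝ)| = (harmonic L : ℝ) := by
    rw [harmonic, Rat.cast_sum]
    refine sum_congr rfl fun n _ => ?_
    push_cast
    rw [abs_of_pos (by positivity), max_eq_right (by linarith [Nat.cast_nonneg (α := ℝ) n]),
      one_div]
  rw [h1]
  have := harmonic_le_one_add_log L
  simp only [nsmul_eq_mul, Nat.cast_ofNat, Nat.cast_zero, Int.cast_zero, abs_zero]
  norm_num
  linarith

/-- The sum factors over the coordinates: one harmonic sum, and `d - 1` counts `4M + 1 ≤ 5M`. -/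
theorem sum_box_one_div_max_le {d : ℕ} (i : Fin d) {M : ℕ} (hM : 1 ≤ M) :
    ∑ k ∈ Fintype.piFinset fun _ : Fin d => Icc (-(2 * M : ℤ)) (2 * M), 1 / max 1 |(k i : ℝ)|
      ≤ (5 * (M : ℝ)) ^ (d - 1) * (4 + 2 * Real.log (2 * M)) := by
  have hM' : (1 : ℝ) ≤ M := by exact_mod_cast hM
  have h1 : ∀ k : Fin d → ℤ, 1 / max 1 |(k i : ℝ)|
      = ∏ j, (if j = i then fun n : ℤ => 1 / max 1 |(n : ℝ)| else fun _ => 1) (k j) := by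
    intro k
    rw [← mul_prod_erase univ _ (mem_univ i), if_pos rfl, prod_congr rfl (g := fun _ => (1 : ℝ))
      fun j hj => by rw [if_neg (ne_of_mem_erase hj)], prod_const_one, mul_one]
  simp only [h1]
  rw [← prod_univ_sum (fun _ : Fin d => Icc (-(2 * M : ℤ)) (2 * M))
      fun j => if j = i then fun n : ℤ => 1 / max 1 |(n : ℝ)| else fun _ => 1,
    ← mul_prod_erase univ _ (mem_univ i), if_pos rfl, prod_congr rfl
      (g := fun _ => (4 * M + 1 : ℝ)) fun j hj => ?_, prod_const, card_erase_of_mem (mem_univ i),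
    card_univ, Fintype.card_fin, mul_comm]
  · have h2 := sum_Icc_neg_one_div_max_le (2 * M)
    push_cast at h2
    have h3 : 0 ≤ Real.log (2 * M) := Real.log_nonneg (by linarith)
    gcongr
    linarith
  · rw [if_neg (ne_of_mem_erase hj), sum_const, Int.card_Icc, nsmul_eq_mul, mul_one]
    have : ((2 * M : ℤ) + 1 - -(2 * M)).toNat = 4 * M + 1 := by omega
    rw [this]; push_cast; rfl

theorem rpow_neg_mul_rpow_le {α δ r R : ℝ} (hα : α ≤ 1) (hδ : 0 ≤ δ) (hr : 1 ≤ r) (hrR : r ≤ R) :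
    r ^ (-α) * r ^ δ ≤ R ^ (1 + δ - α) * (1 / r) := by
  have h0 : 0 < r := by linarith
  calc r ^ (-α) * r ^ δ = r ^ (1 + δ - α) * (1 / r) := by
        rw [one_div, ← Real.rpow_neg_one r, ← Real.rpow_add h0, ← Real.rpow_add h0]
        ring_nf
    _ ≤ _ := by
        gcongr
        linarith

/-- The balance of the number of frequencies against the gain for each of them. -/
theorem exists_frequency_sum_le (d : ℕ) (hd : 1 ≤ d) {δ ε : ℝ} (hδ : 0 < δ) (hδ1 : δ ≤ 1)
    (hε : 0 < ε) :
    ∃ C : ℝ, 0 < C ∧ ∀ α : ℝ, 0 < α → α ≤ 1 → ∀ N M : ℝ, 1 ≤ N → 1 ≤ M →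
      M ≤ 2 * N ^ (δ / (δ + d)) →
      N ^ (-δ) * N ^ ε * (2 * M) ^ (1 + δ - α) * ((5 * M) ^ (d - 1) * (4 + 2 * Real.log (2 * M)))
        ≤ C * N ^ (2 * ε - α * δ / (δ + d)) := by
  have hD : (0 : ℝ) < δ + d := by positivity
  refine ⟨16 * 10 ^ (d - 1) * (4 + 2 * (4 ^ ε / ε)), by positivity, ?_⟩
  intro α hα hα1 N M hN hM hMN
  have hN0 : 0 < N := by linarith
  -- With `M ≈ N^ρ`, the exponent of `N` is `-δ + ρ(1+δ-α) + ρ(d-1) = -ρα`, because `ρ(δ + d) = δ`.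
  set ρ := δ / (δ + d) with hρ
  have hρ0 : 0 ≤ ρ := by positivity
  have hρ1 : ρ ≤ 1 := by
    rw [hρ, div_le_one hD]
    linarith [Nat.cast_nonneg (α := ℝ) d]
  have h1 : (2 * M) ^ (1 + δ - α) ≤ 16 * N ^ (ρ * (1 + δ - α)) := by
    calc (2 * M) ^ (1 + δ - α) ≤ (4 * N ^ ρ) ^ (1 + δ - α) := by
          apply Real.rpow_le_rpow <;> linarith
      _ = 4 ^ (1 + δ - α) * N ^ (ρ * (1 + δ - α)) := by
          rw [Real.mul_rpow (by norm_num) (by positivity), ← Real.rpow_mul hN0.le]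
      _ ≤ 4 ^ (2 : ℝ) * N ^ (ρ * (1 + δ - α)) := by
          gcongr
          · norm_num
          · linarith
      _ = _ := by norm_num
  have h2 : (5 * M) ^ (d - 1) ≤ 10 ^ (d - 1) * N ^ (ρ * (d - 1)) := by
    calc (5 * M) ^ (d - 1) ≤ (10 * N ^ ρ) ^ (d - 1) :=
          pow_le_pow_left₀ (by linarith) (by linarith) _
      _ = _ := by
          rw [mul_pow, ← Real.rpow_natCast (N ^ ρ), ← Real.rpow_mul hN0.le, Nat.cast_sub hd,
            Nat.cast_one]
  have hNe : 1 ≤ N ^ ε := Real.one_le_rpow hN hε.le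
  have h3 : 4 + 2 * Real.log (2 * M) ≤ (4 + 2 * (4 ^ ε / ε)) * N ^ ε := by
    have h4 : Real.log (2 * M) ≤ 4 ^ ε / ε * N ^ ε := by
      calc Real.log (2 * M) ≤ (2 * M) ^ ε / ε := Real.log_le_rpow_div (by positivity) hε
        _ ≤ (4 * N) ^ ε / ε := by
            have : N ^ ρ ≤ N := by simpa using Real.rpow_le_rpow_of_exponent_le hN hρ1
            have h5 : 2 * M ≤ 4 * N := by linarith
            gcongr ?_ ^ ε / ε
        _ = _ := by rw [Real.mul_rpow (by norm_num) hN0.le]; ring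
    linarith
  have hlog : 0 ≤ 4 + 2 * Real.log (2 * M) := by
    have := Real.log_nonneg (show 1 ≤ 2 * M by linarith)
    linarith
  have hexp : N ^ (-δ) * N ^ ε * N ^ (ρ * (1 + δ - α)) * N ^ (ρ * (d - 1)) * N ^ ε
      = N ^ (2 * ε - α * δ / (δ + d)) := by
    simp only [← Real.rpow_add hN0]
    congr 1
    have : ρ * (δ + d) = δ := div_mul_cancel₀ _ hD.ne'
    have h5 : α * δ / (δ + d) = α * ρ := by rw [hρ]; ring
    rw [h5]
    linear_combination this
  calc _ ≤ N ^ (-δ) * N ^ ε * (16 * N ^ (ρ * (1 + δ - α))) *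
        ((10 ^ (d - 1) * N ^ (ρ * (d - 1))) * ((4 + 2 * (4 ^ ε / ε)) * N ^ ε)) := by gcongr
    _ = 16 * 10 ^ (d - 1) * (4 + 2 * (4 ^ ε / ε)) *
        (N ^ (-δ) * N ^ ε * N ^ (ρ * (1 + δ - α)) * N ^ (ρ * (d - 1)) * N ^ ε) := by ring
    _ = _ := by rw [hexp]

/-- The estimate for a single nonzero frequency `k` in the box of size `R`. -/
theorem mul_norm_sum_le_of_ne_zero {d : ℕ} {α δ H C W R N : ℝ} (hα1 : α ≤ 1)
    (hδ : 0 ≤ δ) (hC : 0 ≤ C) (hH : 0 ≤ H) (hW : 0 ≤ W) (hN : 0 < N)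
    {k : Fin d → ℤ} (hk : k ≠ 0) (hkR : ∀ i, |(k i : ℝ)| ≤ R) (i₀ : Fin d) {c S : ℝ}
    (hS : 0 ≤ S) (hc : ∀ i, k i ≠ 0 → c ≤ H * |(k i : ℝ)| ^ (-α))
    (hSk : ∃ i, S ≤ C * ((|(k i : ℝ)| / N) ^ δ * W)) :
    c * S ≤ H * C * (N ^ (-δ) * W * R ^ (1 + δ - α)) * (1 / max 1 |(k i₀ : ℝ)|) := by
  have : Nonempty (Fin d) := ⟨i₀⟩
  -- The decay of `c` is used at the largest entry of `k`, which also dominates the unknown index in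
  -- the Weyl bound. The result is then weakened to the fixed index `i₀`, which makes the sum over
  -- the box factor.
  obtain ⟨m, hm⟩ := Finite.exists_max fun i => |(k i : ℝ)|
  obtain ⟨l, hl⟩ := Function.ne_iff.1 hk
  have hl1 : (1 : ℝ) ≤ |(k l : ℝ)| := by exact_mod_cast Int.one_le_abs hl
  have hr1 : (1 : ℝ) ≤ |(k m : ℝ)| := hl1.trans (hm l)
  have hkm : k m ≠ 0 := fun h => by rw [h] at hr1; norm_num at hr1
  obtain ⟨i, hi⟩ := hSk
  set r := |(k m : ℝ)| with hr
  have hR : 0 ≤ R := by linarith [hkR m]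
  have hSr : S ≤ C * (r ^ δ * N ^ (-δ) * W) := by
    refine hi.trans ?_
    rw [Real.rpow_neg hN.le, ← div_eq_mul_inv, ← Real.div_rpow (by positivity) hN.le]
    gcongr
    exact hm i
  calc c * S ≤ H * r ^ (-α) * (C * (r ^ δ * N ^ (-δ) * W)) := by
        have := hc m hkm
        gcongr
    _ = H * C * (N ^ (-δ) * W) * (r ^ (-α) * r ^ δ) := by ring
    _ ≤ H * C * (N ^ (-δ) * W) * (R ^ (1 + δ - α) * (1 / r)) := by
        exact mul_le_mul_of_nonneg_left (rpow_neg_mul_rpow_le hα1 hδ hr1 (hkR m)) (by positivity)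
    _ ≤ H * C * (N ^ (-δ) * W) * (R ^ (1 + δ - α) * (1 / max 1 |(k i₀ : ℝ)|)) := by
        gcongr
        exact max_le hr1 (hm i₀)
    _ = _ := by ring

theorem ofReal_birkhoffAverage {X : Type*} (T : X → X) (φ : X → ℝ) (N : ℕ) (x : X) :
    ((birkhoffAverage ℝ T φ N x : ℝ) : ℂ) = (∑ n ∈ range N, (φ (T^[n] x) : ℂ)) / N := by
  simp [birkhoffAverage, birkhoffSum, div_eq_inv_mul]

/-- The effective ergodic theorem with an arbitrarily small loss `ε` in the exponent. -/
theorem exists_abs_birkhoffAverage_sub_integral_le (d : ℕ) (hd : 1 ≤ d) {γ ε : ℝ} (hγ : 0 < γ)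
    (hε : 0 < ε) :
    ∃ C : ℝ, 0 < C ∧ ∀ α : NNReal, 0 < α → α ≤ 1 → ∀ φ : C(Torus d, ℝ), MemHolder α φ →
      ∀ ω ∈ DC γ, ∀ N : ℕ, 1 ≤ N → ∀ x : Torus d,
        |birkhoffAverage ℝ (skewMap d ω) φ N x - ∫ y, φ y| ≤ C * holderNorm α φ *
          (N : ℝ) ^ (ε - (α : ℝ) * ((2 : ℝ) ^ (d - 1))⁻¹ / (((2 : ℝ) ^ (d - 1))⁻¹ + d)) := by
  set δ : ℝ := ((2 : ℝ) ^ (d - 1))⁻¹ with hδdef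
  have hδ : 0 < δ := by positivity
  have hδ1 : δ ≤ 1 := inv_le_one_of_one_le₀ (one_le_pow₀ one_le_two)
  obtain ⟨C₁, hC₁, hweyl⟩ := exists_norm_sum_mFourier_iterate_le d hγ (half_pos hε)
  obtain ⟨C₂, hC₂, hfreq⟩ := exists_frequency_sum_le d hd hδ hδ1 (half_pos hε)
  have hD : (0 : ℝ) < δ + d := by positivity
  refine ⟨1 + d + C₁ * C₂, by positivity, fun α hα hα1 φ hφ ω hω N hN x => ?_⟩
  have hN' : (1 : ℝ) ≤ N := by exact_mod_cast hN
  have hN0 : (0 : ℝ) < N := by linarith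
  have hα' : (0 : ℝ) < α := by exact_mod_cast hα
  have hα1' : (α : ℝ) ≤ 1 := by exact_mod_cast hα1
  set ρ := δ / (δ + d) with hρ
  have hρ0 : 0 ≤ ρ := by positivity
  have hNρ : 1 ≤ (N : ℝ) ^ ρ := Real.one_le_rpow hN' hρ0
  set M := ⌈(N : ℝ) ^ ρ⌉₊ with hMdef
  have hM : 1 ≤ M := Nat.one_le_ceil_iff.2 (by linarith)
  have hM' : (1 : ℝ) ≤ M := by exact_mod_cast hM
  have hM_ge : (N : ℝ) ^ ρ ≤ M := Nat.le_ceil _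
  have hM_le : (M : ℝ) ≤ 2 * (N : ℝ) ^ ρ := by
    have := Nat.ceil_lt_add_one (show 0 ≤ (N : ℝ) ^ ρ by linarith)
    linarith
  set H := nnHolderNorm α (φ : Torus d → ℝ) with hH
  have hHle : (H : ℝ) ≤ holderNorm α φ := by
    unfold holderNorm
    linarith [norm_nonneg φ]
  obtain ⟨c, hc0, hck, happ⟩ := exists_trigonometric_approximation hα1 hφ.holderWith hM
  set box := Fintype.piFinset fun _ : Fin d => Icc (-(2 * M : ℤ)) (2 * M) with hbox
  set T := skewMap d ω with hT
  set S : (Fin d → ℤ) → ℂ := fun k => (∑ n ∈ range N, mFourier k (T^[n] x)) / N with hS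
  have hbox0 : (0 : Fin d → ℤ) ∈ box := by
    simp only [hbox, Fintype.mem_piFinset, mem_Icc, Pi.zero_apply]
    intro i; constructor <;> omega
  have hS0 : S 0 = 1 := by
    simp only [hS, mFourier_zero, ContinuousMap.one_apply, sum_const, card_range, nsmul_eq_mul,
      mul_one]
    exact div_self (by exact_mod_cast hN0.ne')
  have hsplit : ((birkhoffAverage ℝ T φ N x - ∫ y, φ y : ℝ) : ℂ)
      = (∑ n ∈ range N, ((φ (T^[n] x) : ℂ) - ∑ k ∈ box, c k * mFourier k (T^[n] x))) / N +
        ∑ k ∈ box.erase 0, c k * S k := by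
    have h1 : (∑ n ∈ range N, ∑ k ∈ box, c k * mFourier k (T^[n] x)) / N
        = ∑ k ∈ box, c k * S k := by
      rw [sum_comm, sum_div]
      refine sum_congr rfl fun k _ => ?_
      rw [hS, ← mul_sum, mul_div_assoc]
    rw [sum_sub_distrib, sub_div, h1, ← add_sum_erase box _ hbox0, hS0, hc0, Complex.ofReal_sub,
      ofReal_birkhoffAverage]
    ring
  have happrox : ‖(∑ n ∈ range N,
      ((φ (T^[n] x) : ℂ) - ∑ k ∈ box, c k * mFourier k (T^[n] x))) / N‖
      ≤ (1 + d) * (H * (M : ℝ) ^ (-(α : ℝ))) := by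
    rw [norm_div, Complex.norm_natCast, div_le_iff₀ hN0]
    refine (norm_sum_le_of_le _ fun n _ => happ _).trans (le_of_eq ?_)
    rw [sum_const, card_range, nsmul_eq_mul, mul_comm]
  have hMα : (M : ℝ) ^ (-(α : ℝ)) ≤ (N : ℝ) ^ (ε - α * δ / (δ + d)) := by
    calc (M : ℝ) ^ (-(α : ℝ)) ≤ ((N : ℝ) ^ ρ) ^ (-(α : ℝ)) :=
          Real.rpow_le_rpow_of_nonpos (by linarith) hM_ge (by linarith)
      _ = (N : ℝ) ^ (-(α * δ / (δ + d))) := by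
          rw [← Real.rpow_mul hN0.le, hρ]; ring_nf
      _ ≤ _ := Real.rpow_le_rpow_of_exponent_le hN' (by linarith)
  have hfreqs : ‖∑ k ∈ box.erase 0, c k * S k‖
      ≤ H * C₁ * (C₂ * (N : ℝ) ^ (ε - α * δ / (δ + d))) := by
    set Q : ℝ := (N : ℝ) ^ (-δ) * (N : ℝ) ^ (ε / 2) * (2 * M) ^ (1 + δ - α) with hQ
    have hterm : ∀ k ∈ box.erase 0, ‖c k * S k‖
        ≤ H * C₁ * Q * (1 / max 1 |(k ⟨0, hd⟩ : ℝ)|) := by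
      intro k hk
      rw [norm_mul]
      have hkbox := Fintype.mem_piFinset.1 (mem_of_mem_erase hk)
      refine mul_norm_sum_le_of_ne_zero hα1' hδ.le (by linarith) H.2 (by positivity) hN0
        (ne_of_mem_erase hk) (fun i => ?_) _ (norm_nonneg _) (hck k) ?_
      · have := mem_Icc.1 (hkbox i)
        rw [abs_le]
        constructor
        · exact_mod_cast this.1
        · exact_mod_cast this.2
      · obtain ⟨i, hi⟩ := hweyl ω hω k (ne_of_mem_erase hk) N hN x
        refine ⟨i, ?_⟩
        simpa only [hS, norm_div, Complex.norm_natCast] using hi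
    have hQ0 : 0 ≤ Q := by positivity
    calc ‖∑ k ∈ box.erase 0, c k * S k‖
        ≤ ∑ k ∈ box.erase 0, H * C₁ * Q * (1 / max 1 |(k ⟨0, hd⟩ : ℝ)|) :=
          norm_sum_le_of_le _ hterm
      _ ≤ ∑ k ∈ box, H * C₁ * Q * (1 / max 1 |(k ⟨0, hd⟩ : ℝ)|) :=
          sum_le_sum_of_subset_of_nonneg (erase_subset _ _) fun k _ _ => by positivity
      _ = H * C₁ * (Q * ∑ k ∈ box, 1 / max 1 |(k ⟨0, hd⟩ : ℝ)|) := by rw [← mul_sum]; ring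
      _ ≤ H * C₁ * (Q * ((5 * (M : ℝ)) ^ (d - 1) * (4 + 2 * Real.log (2 * M)))) := by
          gcongr
          exact sum_box_one_div_max_le _ hM
      _ ≤ _ := by
          have := hfreq α hα' hα1' N M hN' hM' hM_le
          rw [mul_div_cancel₀ ε two_ne_zero] at this
          exact mul_le_mul_of_nonneg_left this (by positivity)
  rw [← Real.norm_eq_abs, ← Complex.norm_real, hsplit]
  calc _ ≤ (1 + d) * (H * (M : ℝ) ^ (-(α : ℝ))) +
        H * C₁ * (C₂ * (N : ℝ) ^ (ε - α * δ / (δ + d))) :=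
        (norm_add_le _ _).trans (add_le_add happrox hfreqs)
    _ ≤ (1 + d) * (H * (N : ℝ) ^ (ε - α * δ / (δ + d))) +
        H * C₁ * (C₂ * (N : ℝ) ^ (ε - α * δ / (δ + d))) := by gcongr
    _ = (1 + d + C₁ * C₂) * H * (N : ℝ) ^ (ε - α * δ / (δ + d)) := by ring
    _ ≤ _ := by gcongr

/-! ### Removing the fixed loss in the exponent. -/

theorem DC_anti {γ γ' : ℝ} (h : γ' ≤ γ) : DC γ ⊆ DC γ' := fun ω hω k hk =>
  le_trans (by gcongr) (hω k hk)

theorem abs_birkhoffAverage_sub_integral_le_two_mul_holderNorm {d : ℕ} (T : Torus d → Torus d)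
    (φ : C(Torus d, ℝ)) (α : NNReal) (N : ℕ) (x : Torus d) :
    |birkhoffAverage ℝ T φ N x - ∫ y, φ y| ≤ 2 * holderNorm α φ := by
  have h1 : |birkhoffAverage ℝ T φ N x| ≤ ‖φ‖ := by
    rcases Nat.eq_zero_or_pos N with rfl | hN
    · simp
    · have hN0 : (0 : ℝ) < N := by exact_mod_cast hN
      rw [birkhoffAverage, birkhoffSum, smul_eq_mul, abs_mul, abs_inv, Nat.abs_cast,
        inv_mul_le_iff₀ hN0]
      refine (abs_sum_le_sum_abs _ _).trans ?_
      refine (sum_le_sum fun n _ => φ.norm_coe_le_norm _).trans (le_of_eq ?_)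
      rw [sum_const, card_range, nsmul_eq_mul]
  have h2 : |∫ y, φ y| ≤ ‖φ‖ := by
    have := norm_integral_le_of_norm_le_const (μ := (volume : Measure (Torus d))) (C := ‖φ‖)
      (f := φ) (Filter.Eventually.of_forall fun y => φ.norm_coe_le_norm y)
    simpa using this
  have h3 : ‖φ‖ ≤ holderNorm α φ := le_add_of_nonneg_right (NNReal.coe_nonneg _)
  linarith [abs_sub (birkhoffAverage ℝ T φ N x) (∫ y, φ y)]

/-- For every sequence `c` there is an index `m(N) → ∞` with `c (m(N)) ≤ N ^ (1 / (m(N) + 1))`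
for large `N`. -/
theorem exists_slow_index (c : ℕ → ℝ) :
    ∃ m : ℕ → ℕ, Filter.Tendsto m Filter.atTop Filter.atTop ∧
      ∀ᶠ N : ℕ in Filter.atTop, c (m N) ≤ (N : ℝ) ^ (1 / ((m N : ℝ) + 1)) := by
  classical
  set P : ℕ → ℕ → Prop := fun N m => c m ≤ (N : ℝ) ^ (1 / ((m : ℝ) + 1)) with hP
  have hlarge : ∀ m, ∀ᶠ N : ℕ in Filter.atTop, P N m := fun m =>
    ((tendsto_rpow_atTop (by positivity)).comp
      tendsto_natCast_atTop_atTop).eventually_ge_atTop (c m)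
  have htend : Filter.Tendsto (fun N => Nat.findGreatest (P N) N) Filter.atTop Filter.atTop := by
    refine Filter.tendsto_atTop.2 fun m => ?_
    filter_upwards [hlarge m, Filter.eventually_ge_atTop m] with N hN hmN
    exact Nat.le_findGreatest hmN hN
  refine ⟨_, htend, ?_⟩
  -- `Nat.findGreatest` also returns `0` when nothing qualifies, so the property is certain only at
  -- a nonzero value.
  filter_upwards [htend.eventually_ge_atTop 1] with N hN
  exact Nat.findGreatest_of_ne_zero (P := P N) rfl (by omega)

end SkewProduct

/-- At each `N` the fixed-loss estimate is used with `γ = ε = 1/(m N + 1)`. Its constant costs at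
most another `N^(1/(m N + 1))` for large `N`, whence `η N = 2/(m N + 1)`, which does not depend on
`γ`. -/
theorem mainTheorem5 (d : ℕ) (hd : 2 ≤ d) :
    ∃ η : ℕ → ℝ, Filter.Tendsto η Filter.atTop (nhds 0) ∧
      ∀ γ : ℝ, 0 < γ → ∃ C : ℝ, 0 < C ∧
        ∀ α : NNReal, 0 < α → α ≤ 1 →
        ∀ φ : C(SkewProduct.Torus d, ℝ), MemHolder α (φ : SkewProduct.Torus d → ℝ) →
        ∀ ω ∈ SkewProduct.DC γ, ∀ N : ℕ, 1 ≤ N → ∀ x : SkewProduct.Torus d,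
          |birkhoffAverage ℝ (SkewProduct.skewMap d ω) φ N x - ∫ y, φ y| ≤
            C * SkewProduct.holderNorm α φ *
              (N : ℝ) ^ (-((α : ℝ) * ((2 : ℝ) ^ (d - 1))⁻¹ /
                (((2 : ℝ) ^ (d - 1))⁻¹ + (d : ℝ)) - η N)) := by
  choose c hc0 hc using fun m : ℕ =>
    SkewProduct.exists_abs_birkhoffAverage_sub_integral_le d (by omega)
      (γ := 1 / ((m : ℝ) + 1)) (ε := 1 / ((m : ℝ) + 1)) (by positivity) (by positivity)
  obtain ⟨m, hm, hcm⟩ := SkewProduct.exists_slow_index c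
  set δ : ℝ := ((2 : ℝ) ^ (d - 1))⁻¹ with hδdef
  have hδ : 0 < δ := by positivity
  have hinv : Filter.Tendsto (fun N => 1 / ((m N : ℝ) + 1)) Filter.atTop (nhds 0) :=
    tendsto_one_div_add_atTop_nhds_zero_nat.comp hm
  refine ⟨fun N => 2 * (1 / ((m N : ℝ) + 1)), by simpa using hinv.const_mul 2, fun γ hγ => ?_⟩
  obtain ⟨N₀, hN₀⟩ := Filter.eventually_atTop.1 (hcm.and (hinv.eventually_le_const hγ))
  -- For `N < N₀` the trivial bound `2 * holderNorm α φ` suffices, since `N ^ (-β) ≥ 1/N ≥ 1/N₀`.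
  -- The `+ 1` makes the constant at least `1`, as needed from `N₀` on.
  refine ⟨2 * N₀ + 1, by positivity, fun α hα hα1 φ hφ ω hω N hN x => ?_⟩
  have hN' : (1 : ℝ) ≤ N := by exact_mod_cast hN
  have hα1' : (α : ℝ) ≤ 1 := by exact_mod_cast hα1
  have hnorm : 0 ≤ SkewProduct.holderNorm α φ := add_nonneg (norm_nonneg _) (NNReal.coe_nonneg _)
  rcases le_or_gt N₀ N with h | h
  · obtain ⟨h1, h2⟩ := hN₀ N h
    have h3 := hc (m N) α hα hα1 φ hφ ω (SkewProduct.DC_anti h2 hω) N hN x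
    calc _ ≤ c (m N) * SkewProduct.holderNorm α φ *
          (N : ℝ) ^ (1 / ((m N : ℝ) + 1) - α * δ / (δ + d)) := h3
      _ ≤ (N : ℝ) ^ (1 / ((m N : ℝ) + 1)) * SkewProduct.holderNorm α φ *
          (N : ℝ) ^ (1 / ((m N : ℝ) + 1) - α * δ / (δ + d)) := by gcongr
      _ = 1 * SkewProduct.holderNorm α φ * ((N : ℝ) ^ (1 / ((m N : ℝ) + 1)) *
          (N : ℝ) ^ (1 / ((m N : ℝ) + 1) - α * δ / (δ + d))) := by ring
      _ = 1 * SkewProduct.holderNorm α φ *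
          (N : ℝ) ^ (-(α * δ / (δ + d) - 2 * (1 / ((m N : ℝ) + 1)))) := by
          rw [← Real.rpow_add (by linarith)]; ring_nf
      _ ≤ _ := by
          gcongr
          linarith [Nat.cast_nonneg (α := ℝ) N₀]
  · have h1 := SkewProduct.abs_birkhoffAverage_sub_integral_le_two_mul_holderNorm
      (SkewProduct.skewMap d ω) φ α N x
    have hexp : α * δ / (δ + d) ≤ 1 := by
      rw [div_le_one (by positivity)]
      nlinarith [Nat.cast_nonneg (α := ℝ) d]
    have h2 : (N₀ : ℝ)⁻¹ ≤
        (N : ℝ) ^ (-(α * δ / (δ + d) - 2 * (1 / ((m N : ℝ) + 1)))) := by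
      calc (N₀ : ℝ)⁻¹ ≤ (N : ℝ)⁻¹ := by
            gcongr
        _ = (N : ℝ) ^ (-1 : ℝ) := (Real.rpow_neg_one _).symm
        _ ≤ _ := by
            refine Real.rpow_le_rpow_of_exponent_le hN' ?_
            have : (0 : ℝ) ≤ 1 / ((m N : ℝ) + 1) := by positivity
            linarith
    have hN0pos : (0 : ℝ) < N₀ := by
      have : (N : ℝ) < N₀ := by exact_mod_cast h
      linarith
    calc _ ≤ 2 * SkewProduct.holderNorm α φ := h1
      _ ≤ (2 * N₀ + 1) * SkewProduct.holderNorm α φ * (N₀ : ℝ)⁻¹ := by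
          rw [mul_right_comm]
          gcongr
          rw [← div_eq_mul_inv, le_div_iff₀ hN0pos]
          linarith
      _ ≤ _ := by gcongr
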